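/- Let $q$ be a prime power, $A=\mathbb{F}_q[t]$, $F=\mathbb{F}_q(t)$, $\pi=1/t$, $F_\infty=\mathbb{F}_q((1/t))$ with ring of integers $A_\infty$, and let $\mathbb{C}_\infty$ be the completion of an algebraic closure of $F_\infty$. Let $\mathcal{T}$ be the Bruhat–Tits tree of $GL_2(F_\infty)$: its vertices are $GL_2(F_\infty)/Z(F_\infty)GL_2(A_\infty)$ and its oriented edges $GL_2(F_\infty)/Z(F_\infty)\mathcal{I}(F_\infty)$, where $Z(F_\infty)$ denotes the scalar matrices and $\mathcal{I}(F_\infty)\subset GL_2(A_\infty)$ the Iwahori subgroup of matrices that are upper triangular mod $\pi$; the origin map is the canonical projection, and reversal of edges is right multiplication by $\begin{pmatrix}0&1\\ \pi&0\end{pmatrix}$. Let $\Gamma_1(t)=\left\{\begin{pmatrix}a&b\\c&d\end{pmatrix}\in GL_2(A): a\equiv d\equiv 1,\ c\equiv 0 \pmod t\right\}$. Let $k\ge 2$ and $m$ be integers, and let $V(k,m)$ be the $\mathbb{C}_\infty$-space of homogeneous polynomials of degree $k-2$ in $X,Y$. For $\gamma=\begin{pmatrix}a&b\\c&d\end{pmatrix}\in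 GL_2(F_\infty)$ and $\omega\in\mathrm{Hom}(V(k,m),\mathbb{C}_\infty)$ put $$(\gamma\omega)(X^jY^{k-2-j})=\det(\gamma)^{1-m}\,\omega\big((aX+bY)^j(cX+dY)^{k-2-j}\big).$$ Let $C^{har}_{k,m}(\Gamma_1(t))$ be the space of functions $\mathbf{c}$ from the oriented edges of $\mathcal{T}$ to $\mathrm{Hom}(V(k,m),\mathbb{C}_\infty)$ such that the sum of $\mathbf{c}(e)$ over all edges $e$ with a given terminal vertex is $0$, $\mathbf{c}$ changes sign when an edge is reversed, and $\mathbf{c}(\gamma e)=\gamma(\mathbf{c}(e))$ for all $\gamma\in\Gamma_1(t)$ and all edges $e$. The normalized Atkin operator is $$U_t(\mathbf{c})(e)=t^{k-m}\sum_{\beta\in\mathbb{F}_q}\begin{pmatrix}1&\beta\\0&t\end{pmatrix}^{-1}\mathbf{c}\left(\begin{pmatrix}1&\beta\\0&t\end{pmatrix}e\right).$$ Then $U_t$ maps $C^{har}_{k,m}(\Gamma_1(t))$ into itself. Let $\overline{e}$ be the edge given by $\begin{pmatrix}0&1\\1&0\end{pmatrix}$. There are harmonic cocycles $\mathbf{c}_j\in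 C^{har}_{k,m}(\Gamma_1(t))$, $0\le j\le k-2$, forming a basis of this space, with $\mathbf{c}_j(\overline{e})(X^iY^{k-2-i})=1$ if $i=j$ and $0$ otherwise (by the basis property they are determined by these values), and for every $j$ $$U_t(\mathbf{c}_j)=-(-t)^{j+1}\binom{k-2-j}{j}\mathbf{c}_j-t^{j+1}\sum_{h\in\mathbb{Z},\,h\neq 0}\left[\binom{k-2-j-h(q-1)}{-h(q-1)}+(-1)^{j+1}\binom{k-2-j-h(q-1)}{j}\right]\mathbf{c}_{j+h(q-1)},$$ where $\mathbf{c}_i=0$ for $i<0$ or $i>k-2$, and $\binom{a}{b}=0$ whenever $a<0$ or $b<0$. Consequently, for every residue class $r$ modulo $q-1$, the span of the $\mathbf{c}_i$ with $i\equiv r \pmod{q-1}$ is stable under $U_t$. -/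

import Mathlib

namespace DrinfeldCocycle

open Polynomial WithZero MonoidWithZeroHom
open scoped NNReal

noncomputable section

variable (Fq : Type*) [Field Fq] [Fintype Fq] [DecidableEq (RatFunc Fq)]

/-! ### The fields `F_∞` and `ℂ_∞` -/

/-- `F_∞ = 𝔽_q((1/t))`, the completion of `F = 𝔽_q(t)` at the place `π = 1/t`. -/
abbrev Finf (Fq : Type*) [Field Fq] [DecidableEq (RatFunc Fq)] : Type _ :=
  RatFunc.CompletionAtInfty Fq

theorem v_algebraMap (Fq : Type*) [Field Fq] [DecidableEq (RatFunc Fq)] (x : RatFunc Fq) :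
    Valued.v (algebraMap (RatFunc Fq) (Finf Fq) x) = RatFunc.inftyValuation Fq x := by
  let _ := RatFunc.inftyValued Fq
  exact Valued.extensionValuation_apply_coe x

instance completeSpace_Finf (Fq : Type*) [Field Fq] [DecidableEq (RatFunc Fq)] :
    CompleteSpace (Finf Fq) :=
  let _ := RatFunc.inftyValued Fq
  inferInstanceAs (CompleteSpace (UniformSpace.Completion (RatFunc Fq)))

theorem one_lt_card (Fq : Type*) [Field Fq] [Fintype Fq] :
    (1 : ℝ≥0) < (Fintype.card Fq : ℝ≥0) := by
  exact_mod_cast Fintype.one_lt_card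

/-- The absolute value of `F_∞` is normalised by `|t| = q`. -/
instance rankOne_Finf : (Valued.v : Valuation (Finf Fq) ℤᵐ⁰).RankOne where
  hom' := (WithZeroMulInt.toNNReal (one_lt_card Fq).ne_zero).comp ValueGroup₀.embedding
  strictMono' := (WithZeroMulInt.toNNReal_strictMono (one_lt_card Fq)).comp
    ValueGroup₀.embedding_strictMono
  exists_val_nontrivial := ⟨algebraMap (RatFunc Fq) (Finf Fq) RatFunc.X, by
    rw [v_algebraMap]; simp⟩

instance nontriviallyNormedField_Finf : NontriviallyNormedField (Finf Fq) :=
  Valued.toNontriviallyNormedField (Finf Fq) ℤᵐ⁰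

instance isUltrametricDist_Finf : IsUltrametricDist (Finf Fq) :=
  Valued.instIsUltrametricDist _ _

/-- The spectral norm: the unique extension of the absolute value of `F_∞` to its algebraic
closure. -/
instance normedField_algebraicClosure : NormedField (AlgebraicClosure (Finf Fq)) :=
  spectralNorm.normedField (Finf Fq) (AlgebraicClosure (Finf Fq))

instance normedAlgebra_algebraicClosure :
    NormedAlgebra (Finf Fq) (AlgebraicClosure (Finf Fq)) :=
  spectralNorm.normedAlgebra (Finf Fq) (AlgebraicClosure (Finf Fq))

/-- `ℂ_∞`, the completion of an algebraic closure of `F_∞`. -/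
abbrev Cinf : Type _ := UniformSpace.Completion (AlgebraicClosure (Finf Fq))

/-- The inclusion of `A = 𝔽_q[t]` into `F_∞`. -/
def ofPoly (Fq : Type*) [Field Fq] [DecidableEq (RatFunc Fq)] : Fq[X] →+* Finf Fq :=
  (algebraMap (RatFunc Fq) (Finf Fq)).comp (algebraMap Fq[X] (RatFunc Fq))

/-- `t` as an element of `F_∞`. -/
def tInf (Fq : Type*) [Field Fq] [DecidableEq (RatFunc Fq)] : Finf Fq := ofPoly Fq X

section
variable {Fq : Type*} [Field Fq] [DecidableEq (RatFunc Fq)]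

theorem ofPoly_injective : Function.Injective (ofPoly Fq) :=
  (algebraMap (RatFunc Fq) (Finf Fq)).injective.comp (IsFractionRing.injective Fq[X] (RatFunc Fq))

theorem tInf_ne_zero : tInf Fq ≠ 0 := by
  rw [tInf, Ne, map_eq_zero_iff _ ofPoly_injective]
  exact X_ne_zero

theorem v_ofPoly {p : Fq[X]} (hp : p ≠ 0) :
    Valued.v (ofPoly Fq p) = exp (p.natDegree : ℤ) := by
  rw [ofPoly, RingHom.comp_apply, v_algebraMap, RatFunc.inftyValuation_apply,
    RatFunc.inftyValuation.polynomial _ hp]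

theorem v_tInf : Valued.v (tInf Fq) = exp (1 : ℤ) := by
  rw [tInf, v_ofPoly X_ne_zero]; simp

/-- The ring of integers `A_∞` of `F_∞`. -/
abbrev Ainf (Fq : Type*) [Field Fq] [DecidableEq (RatFunc Fq)] : Subring (Finf Fq) :=
  (Valued.v : Valuation (Finf Fq) ℤᵐ⁰).integer

theorem exists_eq_inv_tInf_mul {x : Finf Fq} (hx : Valued.v x < 1) :
    ∃ y ∈ Ainf Fq, x = (tInf Fq)⁻¹ * y := by
  refine ⟨tInf Fq * x, ?_, by rw [inv_mul_cancel_left₀ tInf_ne_zero]⟩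
  rw [Valuation.mem_integer_iff, map_mul, v_tInf]
  by_cases h : Valued.v x = 0
  · simp [h]
  · rw [← exp_log h] at hx ⊢
    rw [← exp_add, ← exp_zero, exp_le_exp]
    rw [← exp_zero, exp_lt_exp] at hx
    omega

/-- The residue field of `A_∞` is `𝔽_q`. -/
theorem exists_const {x : Finf Fq} (hx : x ∈ Ainf Fq) :
    ∃ β : Fq, Valued.v (x - ofPoly Fq (C β)) < 1 := by
  obtain ⟨y, hy⟩ : ∃ y : RatFunc Fq, Valued.v (x - algebraMap (RatFunc Fq) (Finf Fq) y) < 1 := by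
    let _ := RatFunc.inftyValued Fq
    have hd : DenseRange (fun y : RatFunc Fq => (algebraMap (RatFunc Fq) (Finf Fq) y)) :=
      UniformSpace.Completion.denseRange_coe (α := RatFunc Fq)
    have ho : IsOpen {z : Finf Fq | Valued.v (x - z) < 1} := by
      have h1 := Valued.isOpen_ball (Finf Fq) 1
      simp only [Valuation.restrict_lt_one_iff] at h1
      exact h1.preimage (continuous_const.sub continuous_id)
    obtain ⟨y, hy⟩ := hd.exists_mem_open ho ⟨x, by simp⟩
    exact ⟨y, hy⟩
  have hx' : Valued.v x ≤ 1 := hx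
  set p := y.num
  set d := y.denom
  have hd0 : d ≠ 0 := y.denom_ne_zero
  have hyd : algebraMap (RatFunc Fq) (Finf Fq) y = ofPoly Fq p / ofPoly Fq d := by
    conv_lhs => rw [← RatFunc.num_div_denom y]
    rw [map_div₀]; rfl
  have hd0' : ofPoly Fq d ≠ 0 := by rwa [Ne, map_eq_zero_iff _ ofPoly_injective]
  suffices h : ∃ β : Fq, (p - C β * d).degree < d.degree by
    obtain ⟨β, hβ⟩ := h
    refine ⟨β, ?_⟩
    have e1 : x - ofPoly Fq (C β) = (x - algebraMap (RatFunc Fq) (Finf Fq) y) +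
        ofPoly Fq (p - C β * d) / ofPoly Fq d := by
      rw [hyd, map_sub, map_mul]; field_simp; ring
    rw [e1]
    refine Valuation.map_add_lt _ hy ?_
    by_cases h0 : p - C β * d = 0
    · simp [h0]
    · rw [map_div₀, v_ofPoly h0, v_ofPoly hd0, ← exp_sub, ← exp_zero, exp_lt_exp]
      have := natDegree_lt_natDegree h0 hβ
      omega
  by_cases hp0 : p = 0
  · exact ⟨0, by simpa [hp0, bot_lt_iff_ne_bot] using hd0⟩
  have hvy : Valued.v (algebraMap (RatFunc Fq) (Finf Fq) y) ≤ 1 := by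
    have := Valuation.map_sub_le (v := (Valued.v : Valuation (Finf Fq) ℤᵐ⁰)) hx' hy.le
    simpa using this
  rw [hyd, map_div₀, v_ofPoly hp0, v_ofPoly hd0, ← exp_sub, ← exp_zero, exp_le_exp] at hvy
  rcases lt_or_eq_of_le (show p.natDegree ≤ d.natDegree by omega) with h | h
  · exact ⟨0, by simpa using degree_lt_degree h⟩
  · have hl : d.leadingCoeff ≠ 0 := leadingCoeff_ne_zero.mpr hd0
    have hl' : p.leadingCoeff ≠ 0 := leadingCoeff_ne_zero.mpr hp0
    refine ⟨p.leadingCoeff / d.leadingCoeff, ?_⟩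
    have hc : p.leadingCoeff / d.leadingCoeff ≠ 0 := div_ne_zero hl' hl
    have hdeg : p.degree = d.degree := by
      rw [degree_eq_natDegree hp0, degree_eq_natDegree hd0, h]
    rw [← hdeg]
    refine degree_sub_lt_left ?_ hp0 ?_
    · rw [degree_C_mul hc, hdeg]
    · rw [leadingCoeff_mul, leadingCoeff_C, div_mul_cancel₀ _ hl]


end

/-! ### The Bruhat-Tits tree -/

section Tree

variable (Fq : Type*) [Field Fq] [DecidableEq (RatFunc Fq)]

/-- `GL₂(F_∞)`. -/
abbrev GLinf : Type _ := Matrix.GeneralLinearGroup (Fin 2) (Finf Fq)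

/-- The scalar matrices `Z(F_∞)`. -/
def scalars : Subgroup (GLinf Fq) := (Matrix.GeneralLinearGroup.scalar (Fin 2)).range

instance scalars_normal : (scalars Fq).Normal := by
  rw [scalars, ← Matrix.GeneralLinearGroup.center_eq_range_scalar]; infer_instance

/-- `GL₂(A_∞)`, as a subgroup of `GL₂(F_∞)`. -/
def GLAinf : Subgroup (GLinf Fq) where
  carrier := {g | ∀ i j, g.val i j ∈ Ainf Fq ∧ (g⁻¹).val i j ∈ Ainf Fq}
  one_mem' i j := by
    fin_cases i <;> fin_cases j <;> simp [zero_mem, one_mem]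
  mul_mem' {a b} ha hb i j := by
    rw [mul_inv_rev, Units.val_mul, Units.val_mul, Matrix.mul_apply, Matrix.mul_apply]
    exact ⟨sum_mem fun x _ => mul_mem (ha i x).1 (hb x j).1,
      sum_mem fun x _ => mul_mem (hb i x).2 (ha x j).2⟩
  inv_mem' {a} ha i j := ⟨(ha i j).2, by rw [inv_inv]; exact (ha i j).1⟩

/-- The Iwahori subgroup `I(F_∞)`: matrices of `GL₂(A_∞)` whose lower left entry lies in `π A_∞`,
where `π = 1/t`. -/
def iwahori : Subgroup (GLinf Fq) where
  carrier := {g | g ∈ GLAinf Fq ∧ ∃ x ∈ Ainf Fq, g.val 1 0 = (tInf Fq)⁻¹ * x}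
  one_mem' := ⟨one_mem _, 0, zero_mem _, by simp⟩
  mul_mem' := by
    rintro a b ⟨ha, x, hx, hax⟩ ⟨hb, y, hy, hby⟩
    refine ⟨mul_mem ha hb, x * b.val 0 0 + a.val 1 1 * y,
      add_mem (mul_mem hx (hb 0 0).1) (mul_mem (ha 1 1).1 hy), ?_⟩
    rw [Units.val_mul, Matrix.mul_apply, Fin.sum_univ_two, hax, hby]
    ring
  inv_mem' := by
    rintro a ⟨ha, x, hx, hax⟩
    refine ⟨inv_mem ha, -(x * ((a⁻¹).val 0 0 * (a⁻¹).val 1 1 - (a⁻¹).val 0 1 * (a⁻¹).val 1 0)),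
      neg_mem (mul_mem hx (sub_mem (mul_mem (ha 0 0).2 (ha 1 1).2)
        (mul_mem (ha 0 1).2 (ha 1 0).2))), ?_⟩
    have h : ∀ i j, (a⁻¹).val i 0 * a.val 0 j + (a⁻¹).val i 1 * a.val 1 j =
        (1 : Matrix (Fin 2) (Fin 2) (Finf Fq)) i j := by
      intro i j
      rw [← Units.inv_mul a, Matrix.mul_apply, Fin.sum_univ_two]
    have h00 := h 0 0
    have h10 := h 1 0
    simp only [Matrix.one_apply_eq, Matrix.one_apply_ne (show (1 : Fin 2) ≠ 0 by decide)] at h00 h10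
    rw [hax] at h00 h10
    linear_combination (-(a⁻¹).val 1 0) * h00 + (a⁻¹).val 0 0 * h10

/-- The vertices of the tree. -/
abbrev Vertex : Type _ := GLinf Fq ⧸ (scalars Fq ⊔ GLAinf Fq)

/-- The oriented edges of the tree. -/
abbrev Edge : Type _ := GLinf Fq ⧸ (scalars Fq ⊔ iwahori Fq)

variable {Fq}

theorem iwahori_le : scalars Fq ⊔ iwahori Fq ≤ scalars Fq ⊔ GLAinf Fq :=
  sup_le_sup_left (fun _ h => h.1) _

/-- The origin of an oriented edge. -/
def origin : Edge Fq → Vertex Fq := Subgroup.quotientMapOfLE iwahori_le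

/-- The matrix `(0 1; π 0)`, which normalises the Iwahori subgroup. -/
def flipMatrix : GLinf Fq where
  val := !![0, 1; (tInf Fq)⁻¹, 0]
  inv := !![0, tInf Fq; 1, 0]
  val_inv := by
    ext i j
    fin_cases i <;> fin_cases j <;> simp [Matrix.mul_apply, inv_mul_cancel₀ tInf_ne_zero]
  inv_val := by
    ext i j
    fin_cases i <;> fin_cases j <;> simp [Matrix.mul_apply, mul_inv_cancel₀ tInf_ne_zero]

theorem flipMatrix_conj_mem {g : GLinf Fq} (hg : g ∈ scalars Fq ⊔ iwahori Fq) :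
    flipMatrix⁻¹ * g * flipMatrix ∈ scalars Fq ⊔ iwahori Fq := by
  have key : ∀ (h : GLinf Fq) (x : Finf Fq), h.val 1 0 = (tInf Fq)⁻¹ * x →
      (flipMatrix⁻¹ * h * flipMatrix).val =
        !![h.val 1 1, x; (tInf Fq)⁻¹ * h.val 0 1, h.val 0 0] := by
    intro h x hx
    change !![0, tInf Fq; 1, 0] * h.val * !![0, 1; (tInf Fq)⁻¹, 0] = _
    have ht := tInf_ne_zero (Fq := Fq)
    rw [Matrix.eta_fin_two h.val, Matrix.mul_fin_two, Matrix.mul_fin_two, hx]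
    ext i j
    fin_cases i <;> fin_cases j <;> simp [ht, mul_comm, mul_left_comm]
  have hpi : (tInf Fq)⁻¹ ∈ Ainf Fq := by
    rw [Valuation.mem_integer_iff, map_inv₀, v_tInf, ← exp_neg, ← exp_zero, exp_le_exp]
    omega
  have hmat : ∀ (h : GLinf Fq) (x : Finf Fq), h ∈ GLAinf Fq → x ∈ Ainf Fq →
      h.val 1 0 = (tInf Fq)⁻¹ * x → ∀ i j, (flipMatrix⁻¹ * h * flipMatrix).val i j ∈ Ainf Fq := by
    intro h x hh hx he i j
    rw [key h x he]
    fin_cases i <;> fin_cases j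
    · exact (hh 1 1).1
    · exact hx
    · exact mul_mem hpi (hh 0 1).1
    · exact (hh 0 0).1
  obtain ⟨z, hz, k, hk, rfl⟩ := Subgroup.mem_sup_of_normal_left.mp hg
  have hk' : flipMatrix⁻¹ * k * flipMatrix ∈ iwahori Fq := by
    obtain ⟨h1, x, hx, hkx⟩ := hk
    obtain ⟨h2, y, hy, hky⟩ := (iwahori Fq).inv_mem ⟨h1, x, hx, hkx⟩
    refine ⟨fun i j => ⟨hmat k x h1 hx hkx i j, ?_⟩, k.val 0 1, (h1 0 1).1, ?_⟩
    · have : (flipMatrix⁻¹ * k * flipMatrix)⁻¹ = flipMatrix⁻¹ * k⁻¹ * flipMatrix := by group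
      rw [this]
      exact hmat k⁻¹ y h2 hy hky i j
    · rw [key k x hkx]; rfl
  have hz' : flipMatrix⁻¹ * z * flipMatrix ∈ scalars Fq := by
    have := (scalars_normal Fq).conj_mem z hz flipMatrix⁻¹
    rwa [inv_inv] at this
  have : flipMatrix⁻¹ * (z * k) * flipMatrix =
      (flipMatrix⁻¹ * z * flipMatrix) * (flipMatrix⁻¹ * k * flipMatrix) := by group
  rw [this]
  exact Subgroup.mul_mem_sup hz' hk'

/-- The same edge with reversed orientation: `g ↦ g (0 1; π 0)` on cosets. -/
def reverse : Edge Fq → Edge Fq :=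
  Quotient.map' (fun g => g * flipMatrix) fun a b h => by
    rw [QuotientGroup.leftRel_apply] at h ⊢
    have : (a * flipMatrix)⁻¹ * (b * flipMatrix) = flipMatrix⁻¹ * (a⁻¹ * b) * flipMatrix := by
      group
    rw [this]
    exact flipMatrix_conj_mem h

/-- The terminus of an oriented edge. -/
def terminus (e : Edge Fq) : Vertex Fq := origin (reverse e)

theorem reverse_reverse (e : Edge Fq) : reverse (reverse e) = e := by
  induction e using QuotientGroup.induction_on with
  | H g =>
    change (QuotientGroup.mk (g * flipMatrix * flipMatrix) : Edge Fq) = QuotientGroup.mk g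
    rw [eq_comm, QuotientGroup.eq]
    refine Subgroup.mem_sup_left ⟨Units.mk0 (tInf Fq)⁻¹ (inv_ne_zero tInf_ne_zero), ?_⟩
    have : g⁻¹ * (g * flipMatrix * flipMatrix) = flipMatrix * flipMatrix := by group
    rw [this]
    ext i j
    change Matrix.scalar (Fin 2) (tInf Fq)⁻¹ i j =
      (!![0, 1; (tInf Fq)⁻¹, 0] * !![0, 1; (tInf Fq)⁻¹, 0] : Matrix _ _ _) i j
    fin_cases i <;> fin_cases j <;> simp [Matrix.mul_apply]

/-- The lower triangular unipotent matrix `(1 0; x 1)`. -/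
def lowerUnipotent (x : Finf Fq) : GLinf Fq where
  val := !![1, 0; x, 1]
  inv := !![1, 0; -x, 1]
  val_inv := by
    ext i j
    fin_cases i <;> fin_cases j <;> simp [Matrix.mul_apply]
  inv_val := by
    ext i j
    fin_cases i <;> fin_cases j <;> simp [Matrix.mul_apply]

/-- The matrix `(0 1; 1 0)`. -/
def swapMatrix : GLinf Fq where
  val := !![0, 1; 1, 0]
  inv := !![0, 1; 1, 0]
  val_inv := by
    ext i j
    fin_cases i <;> fin_cases j <;> simp [Matrix.mul_apply]
  inv_val := by
    ext i j
    fin_cases i <;> fin_cases j <;> simp [Matrix.mul_apply]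

/-- Representatives for `GL₂(A_∞) / I(F_∞)`. -/
theorem exists_rep {k : GLinf Fq} (hk : k ∈ GLAinf Fq) :
    swapMatrix⁻¹ * k ∈ iwahori Fq ∨
      ∃ β : Fq, (lowerUnipotent (ofPoly Fq (C β)))⁻¹ * k ∈ iwahori Fq := by
  have hc : ∀ β : Fq, ofPoly Fq (C β) ∈ Ainf Fq := by
    intro β
    by_cases hβ : β = 0
    · simp [hβ, zero_mem]
    · rw [Valuation.mem_integer_iff, v_ofPoly (by simpa using hβ)]; simp
  by_cases ha : Valued.v (k.val 0 0) < 1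
  · left
    have hs : (swapMatrix (Fq := Fq))⁻¹ ∈ GLAinf Fq := by
      intro i j
      change !![0, 1; 1, 0] i j ∈ Ainf Fq ∧ !![0, 1; 1, 0] i j ∈ Ainf Fq
      fin_cases i <;> fin_cases j <;> simp [zero_mem, one_mem]
    obtain ⟨x, hx, hkx⟩ := exists_eq_inv_tInf_mul ha
    refine ⟨mul_mem hs hk, x, hx, ?_⟩
    change (!![0, 1; 1, 0] * k.val : Matrix (Fin 2) (Fin 2) (Finf Fq)) 1 0 = _
    simp [Matrix.mul_apply, hkx]
  · right
    have hle : Valued.v (k.val 0 0) ≤ 1 := (hk 0 0).1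
    have ha1 : Valued.v (k.val 0 0) = 1 := le_antisymm hle (not_lt.mp ha)
    have ha0 : k.val 0 0 ≠ 0 := by
      intro h; rw [h, map_zero] at ha1; exact zero_ne_one ha1
    have hca : k.val 1 0 / k.val 0 0 ∈ Ainf Fq := by
      rw [Valuation.mem_integer_iff, map_div₀, ha1, div_one]; exact (hk 1 0).1
    obtain ⟨β, hβ⟩ := exists_const hca
    refine ⟨β, ?_⟩
    have hs : (lowerUnipotent (ofPoly Fq (C β)))⁻¹ ∈ GLAinf Fq := by
      intro i j
      change !![1, 0; -(ofPoly Fq (C β)), 1] i j ∈ Ainf Fq ∧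
        !![1, 0; ofPoly Fq (C β), 1] i j ∈ Ainf Fq
      fin_cases i <;> fin_cases j <;> simp [zero_mem, one_mem, hc]
    have hlt : Valued.v (k.val 1 0 - ofPoly Fq (C β) * k.val 0 0) < 1 := by
      have : k.val 1 0 - ofPoly Fq (C β) * k.val 0 0 =
          (k.val 1 0 / k.val 0 0 - ofPoly Fq (C β)) * k.val 0 0 := by field_simp
      rw [this, map_mul, ha1, mul_one]; exact hβ
    obtain ⟨x, hx, hkx⟩ := exists_eq_inv_tInf_mul hlt
    refine ⟨mul_mem hs hk, x, hx, ?_⟩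
    rw [← hkx]
    change (!![1, 0; -(ofPoly Fq (C β)), 1] * k.val : Matrix (Fin 2) (Fin 2) (Finf Fq)) 1 0 = _
    simp [Matrix.mul_apply]
    ring

/-- Only finitely many edges start at a given vertex. -/
theorem finite_origin_eq [Finite Fq] (v : Vertex Fq) : {e : Edge Fq | origin e = v}.Finite := by
  induction v using QuotientGroup.induction_on with
  | H g =>
    have hfin : (insert (QuotientGroup.mk (g * swapMatrix) : Edge Fq)
        (Set.range fun β : Fq =>
          (QuotientGroup.mk (g * lowerUnipotent (ofPoly Fq (C β))) : Edge Fq))).Finite :=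
      (Set.finite_range _).insert _
    refine hfin.subset ?_
    intro e he
    induction e using QuotientGroup.induction_on with
    | H h =>
      have he' : (QuotientGroup.mk h : Vertex Fq) = QuotientGroup.mk g := he
      rw [eq_comm, QuotientGroup.eq] at he'
      obtain ⟨z, hz, k, hk, hzk⟩ := Subgroup.mem_sup_of_normal_left.mp he'
      have hmem : ∀ s : GLinf Fq, s⁻¹ * k ∈ iwahori Fq →
          (QuotientGroup.mk h : Edge Fq) = QuotientGroup.mk (g * s) := by
        intro s hs
        rw [eq_comm, QuotientGroup.eq]
        have : (g * s)⁻¹ * h = (s⁻¹ * z * s) * (s⁻¹ * k) := by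
          have : h = g * (z * k) := by rw [hzk]; group
          rw [this]; group
        rw [this]
        refine Subgroup.mul_mem_sup ?_ hs
        have := (scalars_normal Fq).conj_mem z hz s⁻¹
        rwa [inv_inv] at this
      rcases exists_rep hk with hs | ⟨β, hs⟩
      · exact Or.inl (hmem _ hs)
      · exact Or.inr ⟨β, (hmem _ hs).symm⟩

/-- Only finitely many edges end at a given vertex, so that the sums below are finite. -/
theorem finite_terminus_eq [Finite Fq] (v : Vertex Fq) :
    {e : Edge Fq | terminus e = v}.Finite := by
  refine ((finite_origin_eq v).image reverse).subset ?_
  intro e he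
  exact ⟨reverse e, he, reverse_reverse e⟩

end Tree

/-! ### Harmonic cocycles and the operator `U_t` -/

section Cocycles

variable (Fq : Type*) [Field Fq] [Fintype Fq] [DecidableEq (RatFunc Fq)]
variable (L : Type*) [Field L] [Algebra (Finf Fq) L]

/-- The space of homogeneous polynomials of degree `k - 2` in `X = X 0` and `Y = X 1`, for a weight
`k ≥ 2`. -/
abbrev V (L : Type*) [Field L] (k : ℕ) : Submodule L (MvPolynomial (Fin 2) L) :=
  MvPolynomial.homogeneousSubmodule (Fin 2) L (k - 2)

/-- The monomial `X ^ i * Y ^ (k - 2 - i)`. -/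
def mono (L : Type*) [Field L] (k : ℕ) (i : Fin (k - 1)) : V L k :=
  ⟨MvPolynomial.X 0 ^ (i : ℕ) * MvPolynomial.X 1 ^ (k - 2 - i), by
    have h := ((MvPolynomial.isHomogeneous_X L (0 : Fin 2)).pow (i : ℕ)).mul
      ((MvPolynomial.isHomogeneous_X L (1 : Fin 2)).pow (k - 2 - i))
    have e : 1 * (i : ℕ) + 1 * (k - 2 - i) = k - 2 := by omega
    rwa [e] at h⟩

variable {Fq}

/-- For `γ = (a b; c d)`, the substitution `X ↦ aX + bY`, `Y ↦ cX + dY`. -/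
def subst (γ : GLinf Fq) : MvPolynomial (Fin 2) L →ₐ[L] MvPolynomial (Fin 2) L :=
  MvPolynomial.aeval fun i =>
    MvPolynomial.C (algebraMap (Finf Fq) L (γ.val i 0)) * MvPolynomial.X 0 +
      MvPolynomial.C (algebraMap (Finf Fq) L (γ.val i 1)) * MvPolynomial.X 1


/-- The substitution attached to `γ`, on homogeneous polynomials. -/
def substV (k : ℕ) (γ : GLinf Fq) : V L k →ₗ[L] V L k :=
  (subst L γ).toLinearMap.restrict fun p hp => by
    have h : ∀ i : Fin 2, (MvPolynomial.C (algebraMap (Finf Fq) L (γ.val i 0)) * MvPolynomial.X 0 +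
        MvPolynomial.C (algebraMap (Finf Fq) L (γ.val i 1)) * MvPolynomial.X 1 :
          MvPolynomial (Fin 2) L).IsHomogeneous 1 := fun i =>
      ((MvPolynomial.isHomogeneous_C_mul_X _ _).add (MvPolynomial.isHomogeneous_C_mul_X _ _))
    have := MvPolynomial.IsHomogeneous.aeval hp _ h
    rwa [one_mul] at this

/-- The action of `γ = (a b; c d) ∈ GL₂(F_∞)` on `ω ∈ Hom(V(k,m), L)`:
`(γω)(X ^ j Y ^ (k-2-j)) = det(γ)^(1-m) ω((aX + bY) ^ j (cX + dY) ^ (k-2-j))`. -/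
def act (k : ℕ) (m : ℤ) (γ : GLinf Fq) : Module.Dual L (V L k) →ₗ[L] Module.Dual L (V L k) :=
  (algebraMap (Finf Fq) L γ.val.det) ^ (1 - m) • (substV L k γ).dualMap

/-- The congruence subgroup `Γ₁(𝔫)` of `GL₂(A)`, `A = 𝔽_q[t]`. -/
def Gamma1 (𝔫 : Ideal Fq[X]) : Subgroup (Matrix.GeneralLinearGroup (Fin 2) Fq[X]) where
  carrier := {γ | γ.val 0 0 - 1 ∈ 𝔫 ∧ γ.val 1 1 - 1 ∈ 𝔫 ∧ γ.val 1 0 ∈ 𝔫}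
  one_mem' := by simp
  mul_mem' := by
    rintro a b ⟨ha, ha', ha''⟩ ⟨hb, hb', hb''⟩
    simp only [Set.mem_ofPred_eq, Units.val_mul, Matrix.mul_apply, Fin.sum_univ_two]
    refine ⟨?_, ?_, ?_⟩
    · convert 𝔫.add_mem (𝔫.add_mem (𝔫.mul_mem_right (b.val 0 0) ha) hb)
        (𝔫.mul_mem_left (a.val 0 1) hb'') using 1
      ring
    · convert 𝔫.add_mem (𝔫.add_mem (𝔫.mul_mem_right (b.val 1 1) ha') hb')
        (𝔫.mul_mem_right (b.val 0 1) ha'') using 1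
      ring
    · exact 𝔫.add_mem (𝔫.mul_mem_right _ ha'') (𝔫.mul_mem_left _ hb'')
  inv_mem' := by
    rintro a ⟨ha, ha', ha''⟩
    have h : ∀ i j, a.val i 0 * (a⁻¹).val 0 j + a.val i 1 * (a⁻¹).val 1 j =
        (1 : Matrix (Fin 2) (Fin 2) Fq[X]) i j := by
      intro i j
      rw [← Units.mul_inv a, Matrix.mul_apply, Fin.sum_univ_two]
    have h00 := h 0 0
    have h10 := h 1 0
    have h11 := h 1 1
    simp only [Matrix.one_apply_eq, Matrix.one_apply_ne (show (1 : Fin 2) ≠ 0 by decide)]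
      at h00 h10 h11
    have h3 : (a⁻¹).val 1 0 ∈ 𝔫 := by
      have := 𝔫.neg_mem (𝔫.add_mem (𝔫.mul_mem_right ((a⁻¹).val 0 0) ha'')
        (𝔫.mul_mem_right ((a⁻¹).val 1 0) ha'))
      convert this using 1
      linear_combination h10
    refine ⟨?_, ?_, h3⟩
    · have := 𝔫.neg_mem (𝔫.add_mem (𝔫.mul_mem_right ((a⁻¹).val 0 0) ha)
        (𝔫.mul_mem_left (a.val 0 1) h3))
      convert this using 1
      linear_combination h00
    · have := 𝔫.neg_mem (𝔫.add_mem (𝔫.mul_mem_right ((a⁻¹).val 0 1) ha'')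
        (𝔫.mul_mem_right ((a⁻¹).val 1 1) ha'))
      convert this using 1
      linear_combination h11

/-- The space `C^har_{k,m}(Γ)` of harmonic cocycles of weight `k` and type `m` for
`Γ ≤ GL₂(𝔽_q[t])`: the functions on oriented edges with values in `Hom(V(k,m), L)` which are
harmonic, antisymmetric and `Γ`-equivariant. -/
def harmonicCocycles (k : ℕ) (m : ℤ) (Γ : Subgroup (Matrix.GeneralLinearGroup (Fin 2) Fq[X])) :
    Submodule L (Edge Fq → Module.Dual L (V L k)) where
  carrier := {c |
    (∀ v : Vertex Fq, ∑ᶠ (e : Edge Fq) (_ : terminus e = v), c e = 0) ∧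
    (∀ e : Edge Fq, c (reverse e) = -c e) ∧
    (∀ γ ∈ Γ, ∀ e : Edge Fq, c (Matrix.GeneralLinearGroup.map (ofPoly Fq) γ • e) =
      act L k m (Matrix.GeneralLinearGroup.map (ofPoly Fq) γ) (c e))}
  zero_mem' := by simp
  add_mem' := by
    rintro c d ⟨hc, hc', hc''⟩ ⟨hd, hd', hd''⟩
    refine ⟨fun v => ?_, fun e => ?_, fun γ hγ e => ?_⟩
    · have := finsum_mem_add_distrib (f := c) (g := d) (finite_terminus_eq v)
      simp only [Set.mem_ofPred_eq] at this
      simp only [Pi.add_apply, this, hc v, hd v, add_zero]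
    · simp only [Pi.add_apply, hc', hd']; abel
    · simp only [Pi.add_apply, hc'' γ hγ, hd'' γ hγ, map_add]
  smul_mem' := by
    rintro r c ⟨hc, hc', hc''⟩
    refine ⟨fun v => ?_, fun e => ?_, fun γ hγ e => ?_⟩
    · have := smul_finsum_mem (r := r) (f := c) (finite_terminus_eq v)
      simp only [Set.mem_ofPred_eq] at this
      simp only [Pi.smul_apply, ← this, hc v, smul_zero]
    · simp only [Pi.smul_apply, hc', smul_neg]
    · simp only [Pi.smul_apply, hc'' γ hγ, map_smul]

/-- The matrix `(1 β; 0 t)`. -/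
def heckeMatrix (β : Fq) : GLinf Fq where
  val := !![1, ofPoly Fq (C β); 0, tInf Fq]
  inv := !![1, -(ofPoly Fq (C β) / tInf Fq); 0, (tInf Fq)⁻¹]
  val_inv := by
    have ht := tInf_ne_zero (Fq := Fq)
    ext i j
    fin_cases i <;> fin_cases j <;> simp [Matrix.mul_apply, ht]
    field_simp
    ring
  inv_val := by
    have ht := tInf_ne_zero (Fq := Fq)
    ext i j
    fin_cases i <;> fin_cases j <;> simp [Matrix.mul_apply, ht]

/-- The normalised Atkin operator
`(U_t c)(e) = t^(k-m) ∑_{β ∈ 𝔽_q} (1 β; 0 t)⁻¹ c((1 β; 0 t) e)`, on arbitrary functions on oriented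
edges. -/
def Ut (k : ℕ) (m : ℤ) :
    (Edge Fq → Module.Dual L (V L k)) →ₗ[L] (Edge Fq → Module.Dual L (V L k)) where
  toFun c e := (algebraMap (Finf Fq) L (tInf Fq)) ^ ((k : ℤ) - m) •
    ∑ β : Fq, act L k m (heckeMatrix β)⁻¹ (c (heckeMatrix β • e))
  map_add' c d := by
    funext e
    simp only [Pi.add_apply, map_add, Finset.sum_add_distrib, smul_add]
  map_smul' r c := by
    funext e
    simp only [Pi.smul_apply, map_smul, ← Finset.smul_sum, RingHom.id_apply]
    rw [smul_comm]

variable (Fq) in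
/-- The edge `ē`, the class of `(0 1; 1 0)`. -/
def eBar : Edge Fq := QuotientGroup.mk swapMatrix

/-- Extension of a finite family indexed by `0 ≤ i ≤ k - 2` to all integers, by zero. -/
def extendByZero {M : Type*} [Zero M] {k : ℕ} (c : Fin (k - 1) → M) (i : ℤ) : M :=
  if h : 0 ≤ i ∧ i.toNat < k - 1 then c ⟨i.toNat, h.2⟩ else 0

/-- The binomial coefficient `C(a, b)` for integers, which is zero when `a < 0` or `b < 0`. -/
def intChoose (a b : ℤ) : ℕ :=
  if 0 ≤ a ∧ 0 ≤ b then a.toNat.choose b.toNat else 0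

end Cocycles
end
end DrinfeldCocycle

open DrinfeldCocycle

namespace DrinfeldCocycle

open Polynomial WithZero MonoidWithZeroHom
open scoped NNReal

noncomputable section

/-! ### Edges, vertices and the star of a vertex, in matrix terms. -/

section TreeGeometry

variable {Fq : Type*} [Field Fq] [DecidableEq (RatFunc Fq)]

/-! The quotient of the tree by `Γ₁(t)` is a line, infinite in both directions, and it lifts to the
apartment of the vertices `diag(t ^ n, 1)`. Its edges `stdEdge n` run from `diag(t ^ n, 1)` to
`diag(t ^ (n - 1), 1)`, and `stdEdge 0` is `ē`. Every edge is a translate of some `stdEdge n` or of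
its reverse (`exists_smul_stdEdge`). No two of these are equivalent, and the stabiliser of `stdEdge
n` consists of upper unipotent matrices if `n ≥ 0` and of lower unipotent ones if `n ≤ 0`, with the
degree of the entry bounded in terms of `|n|` (`smul_stdEdge_eq`, `smul_stdEdge_ne_reverse`). In
particular `ē` has trivial stabiliser.

At a vertex of the apartment all edges but one are unipotent translates of a single edge.
Harmonicity therefore says that the value one step further from `ē` is the sum of the `q` translates
of the previous value. This recursion determines a cocycle from its value at `ē`. Conversely,
starting from any functional, the iterated sum is invariant under the stabilisers
(`unipotentSum_invariant`), so it extends to a cocycle. Hence evaluation at `ē` is an isomorphism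
onto `Hom(V(k,m), L)` (`evalEquiv`), and the `c_j` correspond to the basis dual to the monomials.

The operator `U_t` preserves the cocycles because right multiplication by `Γ₁(t)` permutes the
matrices `(1 β; 0 t)` up to left multiplication by `Γ₁(t)` (`exists_heckeMatrix_mul`). Its matrix
can be read off at `ē`: the term `β = 0` lands on `stdEdge (-1)`, where the value is a sum over `α ∈
𝔽_q`, and each `β ≠ 0` lands on a translate of the reversed `ē` (`Ut_apply_eBar`). Expanding by the
binomial theorem leaves power sums over `𝔽_q`, which vanish unless `q - 1` divides the exponent.
This gives both the formula and the congruence `i ≡ j` modulo `q - 1`. -/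

/-- The matrix `diag(x, 1)`. -/
def diagMatrix (x : Finf Fq) (hx : x ≠ 0) : GLinf Fq where
  val := !![x, 0; 0, 1]
  inv := !![x⁻¹, 0; 0, 1]
  val_inv := by
    ext i j
    fin_cases i <;> fin_cases j <;> simp [Matrix.mul_apply, hx]
  inv_val := by
    ext i j
    fin_cases i <;> fin_cases j <;> simp [Matrix.mul_apply, hx]

/-- The matrix `diag(t ^ n, 1)`. -/
def diagT (n : ℤ) : GLinf Fq := diagMatrix (tInf Fq ^ n) (zpow_ne_zero n tInf_ne_zero)

/-- The upper triangular unipotent matrix `(1 x; 0 1)`. -/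
def upperUnipotent (x : Finf Fq) : GLinf Fq where
  val := !![1, x; 0, 1]
  inv := !![1, -x; 0, 1]
  val_inv := by
    ext i j
    fin_cases i <;> fin_cases j <;> simp [Matrix.mul_apply]
  inv_val := by
    ext i j
    fin_cases i <;> fin_cases j <;> simp [Matrix.mul_apply]

/-- The scalar matrix with entry `z`. -/
def scalarMatrix (z : Finf Fq) (hz : z ≠ 0) : GLinf Fq where
  val := !![z, 0; 0, z]
  inv := !![z⁻¹, 0; 0, z⁻¹]
  val_inv := by
    ext i j
    fin_cases i <;> fin_cases j <;> simp [Matrix.mul_apply, hz]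
  inv_val := by
    ext i j
    fin_cases i <;> fin_cases j <;> simp [Matrix.mul_apply, hz]

theorem val_diagMatrix (x : Finf Fq) (hx : x ≠ 0) :
    (diagMatrix x hx).val = !![x, 0; 0, 1] := rfl

theorem val_diagT (n : ℤ) : (diagT (Fq := Fq) n).val = !![tInf Fq ^ n, 0; 0, 1] := rfl

theorem val_upperUnipotent (x : Finf Fq) : (upperUnipotent x).val = !![1, x; 0, 1] := rfl

theorem val_lowerUnipotent (x : Finf Fq) : (lowerUnipotent x).val = !![1, 0; x, 1] := rfl

theorem val_swapMatrix : (swapMatrix (Fq := Fq)).val = !![0, 1; 1, 0] := rfl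

theorem val_flipMatrix : (flipMatrix (Fq := Fq)).val = !![0, 1; (tInf Fq)⁻¹, 0] := rfl

theorem val_scalarMatrix (z : Finf Fq) (hz : z ≠ 0) :
    (scalarMatrix z hz).val = !![z, 0; 0, z] := rfl

theorem scalarMatrix_mem (z : Finf Fq) (hz : z ≠ 0) : scalarMatrix z hz ∈ scalars Fq := by
  refine ⟨Units.mk0 z hz, ?_⟩
  ext i j
  change Matrix.scalar (Fin 2) z i j = !![z, 0; 0, z] i j
  fin_cases i <;> fin_cases j <;> simp

theorem exists_eq_scalarMatrix {g : GLinf Fq} (hg : g ∈ scalars Fq) :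
    ∃ (z : Finf Fq) (hz : z ≠ 0), g = scalarMatrix z hz := by
  obtain ⟨u, rfl⟩ := hg
  refine ⟨u, u.ne_zero, ?_⟩
  ext i j
  change Matrix.scalar (Fin 2) (u : Finf Fq) i j = !![(u : Finf Fq), 0; 0, u] i j
  fin_cases i <;> fin_cases j <;> simp

theorem det_ne_zero (g : GLinf Fq) : g.val.det ≠ 0 :=
  ((Matrix.isUnit_iff_isUnit_det _).mp g.isUnit).ne_zero

theorem coe_inv_eq (g : GLinf Fq) :
    (g⁻¹).val = (g.val.det)⁻¹ • !![g.val 1 1, -g.val 0 1; -g.val 1 0, g.val 0 0] := by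
  rw [Matrix.coe_units_inv, Matrix.inv_def, Matrix.adjugate_fin_two, Ring.inverse_eq_inv']

/-- A matrix with integral entries and unit determinant lies in `GL₂(A_∞)`. -/
theorem mem_GLAinf {g : GLinf Fq} (h : ∀ i j, Valued.v (g.val i j) ≤ 1)
    (hdet : Valued.v g.val.det = 1) : g ∈ GLAinf Fq := by
  intro i j
  refine ⟨h i j, ?_⟩
  rw [coe_inv_eq, Valuation.mem_integer_iff, Matrix.smul_apply, smul_eq_mul, map_mul, map_inv₀,
    hdet, inv_one, one_mul]
  fin_cases i <;> fin_cases j <;> simp [h]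

/-- Matrices whose entries satisfy the Iwahori conditions lie in the Iwahori subgroup. -/
theorem mem_iwahori {g : GLinf Fq} (h00 : Valued.v (g.val 0 0) = 1)
    (h01 : Valued.v (g.val 0 1) ≤ 1) (h10 : Valued.v (g.val 1 0) < 1)
    (h11 : Valued.v (g.val 1 1) = 1) : g ∈ iwahori Fq := by
  refine ⟨mem_GLAinf ?_ ?_, exists_eq_inv_tInf_mul h10⟩
  · intro i j
    fin_cases i <;> fin_cases j
    exacts [h00.le, h01, h10.le, h11.le]
  · rw [Matrix.det_fin_two, Valuation.map_sub_eq_of_lt_left]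
    · rw [map_mul, h00, h11, one_mul]
    · rw [map_mul, map_mul, h00, h11, one_mul]
      exact (mul_le_of_le_one_left' h01).trans_lt h10

/-- In the diagonal entries of `g g⁻¹ = 1` and `g⁻¹ g = 1`, the product involving the lower left
entry of `g` has absolute value below 1. The other product then has absolute value 1, and both its
factors are integral, hence units. -/
theorem exists_of_mem_iwahori {g : GLinf Fq} (hg : g ∈ iwahori Fq) :
    Valued.v (g.val 0 0) = 1 ∧ Valued.v (g.val 0 1) ≤ 1 ∧ Valued.v (g.val 1 0) < 1 ∧
      Valued.v (g.val 1 1) = 1 := by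
  obtain ⟨hg, x, hx, hgx⟩ := hg
  have hx' : Valued.v x ≤ 1 := hx
  have hlt : Valued.v (g.val 1 0) < 1 := by
    rw [hgx, map_mul, map_inv₀, v_tInf, ← exp_neg]
    refine (mul_le_of_le_one_right' hx').trans_lt ?_
    rw [← exp_zero, exp_lt_exp]; omega
  have h : ∀ i j, Valued.v (g.val i j) ≤ 1 := fun i j => (hg i j).1
  have h' : ∀ i j, Valued.v ((g⁻¹).val i j) ≤ 1 := fun i j => (hg i j).2
  have hl : ∀ i j, g.val i 0 * (g⁻¹).val 0 j + g.val i 1 * (g⁻¹).val 1 j =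
      (1 : Matrix (Fin 2) (Fin 2) (Finf Fq)) i j := by
    intro i j
    rw [← Units.mul_inv g, Matrix.mul_apply, Fin.sum_univ_two]
  have hr : ∀ i j, (g⁻¹).val i 0 * g.val 0 j + (g⁻¹).val i 1 * g.val 1 j =
      (1 : Matrix (Fin 2) (Fin 2) (Finf Fq)) i j := by
    intro i j
    rw [← Units.inv_mul g, Matrix.mul_apply, Fin.sum_univ_two]
  have e2 := hl 1 1
  have e3 := hr 0 0
  rw [Matrix.one_apply_eq] at e2 e3
  have key : ∀ a b c d : Finf Fq, a * b + c * d = 1 → Valued.v (c * d) < 1 →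
      Valued.v (a * b) = 1 := by
    intro a b c d h hlt
    rw [eq_sub_of_add_eq h, Valuation.map_sub_eq_of_lt_left _ (by rwa [map_one]), map_one]
  have key' : ∀ a b : Finf Fq, Valued.v a ≤ 1 → Valued.v b ≤ 1 → Valued.v (a * b) = 1 →
      Valued.v a = 1 := by
    intro a b ha hb hab
    refine le_antisymm ha ?_
    rw [← hab, map_mul]
    exact mul_le_of_le_one_right' hb
  refine ⟨?_, h 0 1, hlt, ?_⟩
  · refine key' _ _ (h 0 0) (h' 0 0) ?_
    rw [mul_comm]
    refine key _ _ _ _ e3 ?_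
    rw [map_mul]
    exact (mul_le_of_le_one_left' (h' 0 1)).trans_lt hlt
  · refine key' _ _ (h 1 1) (h' 1 1) ?_
    rw [add_comm] at e2
    refine key _ _ _ _ e2 ?_
    rw [map_mul]
    exact (mul_le_of_le_one_right' (h' 0 1)).trans_lt hlt

theorem mk_eq_mk_iff {g h : GLinf Fq} :
    (QuotientGroup.mk g : Edge Fq) = QuotientGroup.mk h ↔
      ∃ (z : Finf Fq) (hz : z ≠ 0), ∃ k ∈ iwahori Fq, h = g * (scalarMatrix z hz * k) := by
  rw [QuotientGroup.eq]
  constructor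
  · intro hm
    obtain ⟨s, hs, k, hk, he⟩ := Subgroup.mem_sup_of_normal_left.mp hm
    obtain ⟨z, hz, rfl⟩ := exists_eq_scalarMatrix hs
    exact ⟨z, hz, k, hk, by rw [he]; group⟩
  · rintro ⟨z, hz, k, hk, rfl⟩
    rw [inv_mul_cancel_left]
    exact Subgroup.mul_mem_sup (scalarMatrix_mem z hz) hk

/-- A criterion for two matrices to define the same edge. -/
theorem mk_eq_mk {g h : GLinf Fq} (z : Finf Fq) (hz : z ≠ 0) (k : GLinf Fq) (hk : k ∈ iwahori Fq)
    (he : h.val = z • (g.val * k.val)) :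
    (QuotientGroup.mk g : Edge Fq) = QuotientGroup.mk h := by
  refine mk_eq_mk_iff.mpr ⟨z, hz, k, hk, Units.ext ?_⟩
  rw [he, Units.val_mul, Units.val_mul, val_scalarMatrix, ← Matrix.mul_assoc]
  have : (!![z, 0; 0, z] : Matrix (Fin 2) (Fin 2) (Finf Fq)) = z • 1 := by
    ext i j; fin_cases i <;> fin_cases j <;> simp
  rw [this, Matrix.mul_smul, mul_one, Matrix.smul_mul]

theorem v_ofPoly_C_le (β : Fq) : Valued.v (ofPoly Fq (C β)) ≤ 1 := by
  by_cases hβ : β = 0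
  · simp [hβ]
  · rw [v_ofPoly (by simpa using hβ)]; simp

/-- The value of an edge with the same origin as `g`. -/
theorem origin_eq_mk {g : GLinf Fq} {e : Edge Fq} (he : origin e = QuotientGroup.mk g) :
    e = QuotientGroup.mk (g * swapMatrix) ∨
      ∃ β : Fq, e = QuotientGroup.mk (g * lowerUnipotent (ofPoly Fq (C β))) := by
  induction e using QuotientGroup.induction_on with
  | H h =>
    have he' : (QuotientGroup.mk h : Vertex Fq) = QuotientGroup.mk g := he
    rw [eq_comm, QuotientGroup.eq] at he'
    obtain ⟨z, hz, k, hk, hzk⟩ := Subgroup.mem_sup_of_normal_left.mp he'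
    have hmem : ∀ s : GLinf Fq, s⁻¹ * k ∈ iwahori Fq →
        (QuotientGroup.mk h : Edge Fq) = QuotientGroup.mk (g * s) := by
      intro s hs
      rw [eq_comm, QuotientGroup.eq]
      have : (g * s)⁻¹ * h = (s⁻¹ * z * s) * (s⁻¹ * k) := by
        have : h = g * (z * k) := by rw [hzk]; group
        rw [this]; group
      rw [this]
      refine Subgroup.mul_mem_sup ?_ hs
      have := (scalars_normal Fq).conj_mem z hz s⁻¹
      rwa [inv_inv] at this
    rcases exists_rep hk with hs | ⟨β, hs⟩
    · exact Or.inl (hmem _ hs)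
    · exact Or.inr ⟨β, hmem _ hs⟩

theorem swapMatrix_mem : swapMatrix ∈ GLAinf Fq := by
  refine mem_GLAinf ?_ ?_
  · intro i j
    rw [val_swapMatrix]
    fin_cases i <;> fin_cases j <;> simp
  · rw [val_swapMatrix, Matrix.det_fin_two]; simp

theorem lowerUnipotent_mem {x : Finf Fq} (hx : Valued.v x ≤ 1) : lowerUnipotent x ∈ GLAinf Fq := by
  refine mem_GLAinf ?_ ?_
  · intro i j
    rw [val_lowerUnipotent]
    fin_cases i <;> fin_cases j <;> simp [hx]
  · rw [val_lowerUnipotent, Matrix.det_fin_two]; simp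

theorem upperUnipotent_mem {x : Finf Fq} (hx : Valued.v x ≤ 1) : upperUnipotent x ∈ GLAinf Fq := by
  refine mem_GLAinf ?_ ?_
  · intro i j
    rw [val_upperUnipotent]
    fin_cases i <;> fin_cases j <;> simp [hx]
  · rw [val_upperUnipotent, Matrix.det_fin_two]; simp

theorem origin_mk_mul (g : GLinf Fq) {k : GLinf Fq} (hk : k ∈ GLAinf Fq) :
    origin (QuotientGroup.mk (g * k)) = QuotientGroup.mk g := by
  change (QuotientGroup.mk (g * k) : Vertex Fq) = _
  rw [eq_comm, QuotientGroup.eq, inv_mul_cancel_left]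
  exact Subgroup.mem_sup_right hk

/-- Equality would force the lower right entry of an Iwahori matrix, which is a unit, to vanish. -/
theorem mk_mul_swap_ne (g : GLinf Fq) (β : Fq) :
    (QuotientGroup.mk (g * swapMatrix) : Edge Fq) ≠
      QuotientGroup.mk (g * lowerUnipotent (ofPoly Fq (C β))) := by
  intro h
  obtain ⟨z, hz, k, hk, he⟩ := mk_eq_mk_iff.mp h
  rw [mul_assoc, mul_right_inj] at he
  obtain ⟨h00, h01, h10, h11⟩ := exists_of_mem_iwahori hk
  have := congrArg Units.val he
  simp only [Units.val_mul, val_swapMatrix, val_scalarMatrix, val_lowerUnipotent] at this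
  rw [Matrix.eta_fin_two k.val, Matrix.mul_fin_two, Matrix.mul_fin_two] at this
  have e0 := congrFun (congrFun this 0) 0
  have e1 := congrFun (congrFun this 0) 1
  simp at e0 e1
  rcases e1 with e1 | e1
  · exact hz e1
  · rw [e1, map_zero] at h11; exact zero_ne_one h11

/-- If two of these edges agree, the difference of the constants has absolute value below 1, while a
nonzero constant has absolute value 1. -/
theorem mk_mul_lower_injective (g : GLinf Fq) : Function.Injective fun β : Fq =>
    (QuotientGroup.mk (g * lowerUnipotent (ofPoly Fq (C β))) : Edge Fq) := by
  intro β β' h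
  obtain ⟨z, hz, k, hk, he⟩ := mk_eq_mk_iff.mp h
  rw [mul_assoc, mul_right_inj] at he
  obtain ⟨h00, h01, h10, h11⟩ := exists_of_mem_iwahori hk
  have := congrArg Units.val he
  simp only [Units.val_mul, val_scalarMatrix, val_lowerUnipotent] at this
  rw [Matrix.eta_fin_two k.val, Matrix.mul_fin_two, Matrix.mul_fin_two] at this
  have e0 := congrFun (congrFun this 0) 0
  have e1 := congrFun (congrFun this 1) 0
  simp at e0 e1
  have hz1 : Valued.v z = 1 := by
    have := congrArg Valued.v e0
    rwa [map_mul, h00, mul_one, map_one, eq_comm] at this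
  have e2 : ofPoly Fq (C (β' - β)) = z * k.val 1 0 := by
    rw [C_sub, map_sub, e1, ← e0]; ring
  by_contra hne
  have hne' : β' - β ≠ 0 := sub_ne_zero.mpr (Ne.symm hne)
  have := congrArg Valued.v e2
  rw [v_ofPoly (C_ne_zero.mpr hne'), map_mul, hz1, one_mul] at this
  rw [← this] at h10
  simp at h10

/-- The sum of a function over the edges with given origin. -/
theorem finsum_origin_eq [Fintype Fq] {M : Type*} [AddCommMonoid M] (f : Edge Fq → M)
    (g : GLinf Fq) :
    ∑ᶠ (e : Edge Fq) (_ : origin e = QuotientGroup.mk g), f e =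
      f (QuotientGroup.mk (g * swapMatrix)) +
        ∑ β : Fq, f (QuotientGroup.mk (g * lowerUnipotent (ofPoly Fq (C β)))) := by
  classical
  have hset : {e : Edge Fq | origin e = QuotientGroup.mk g} =
      insert (QuotientGroup.mk (g * swapMatrix)) (Set.range fun β : Fq =>
        (QuotientGroup.mk (g * lowerUnipotent (ofPoly Fq (C β))) : Edge Fq)) := by
    ext e
    constructor
    · intro he
      rcases origin_eq_mk he with h | ⟨β, h⟩
      · exact Or.inl h
      · exact Or.inr ⟨β, h.symm⟩
    · rintro (rfl | ⟨β, rfl⟩)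
      · exact origin_mk_mul g swapMatrix_mem
      · exact origin_mk_mul g (lowerUnipotent_mem (v_ofPoly_C_le β))
  change ∑ᶠ (e : Edge Fq) (_ : e ∈ {e : Edge Fq | origin e = QuotientGroup.mk g}), f e = _
  rw [hset, finsum_mem_insert _ _ (Set.finite_range _), finsum_mem_range (mk_mul_lower_injective g),
    finsum_eq_sum_of_fintype]
  rintro ⟨β, h⟩
  exact mk_mul_swap_ne g β h.symm

/-- Reindexing by the reversal involution turns the harmonicity condition into one about outgoing
edges, which are easier to list. -/
theorem finsum_terminus_eq_neg {M : Type*} [AddCommGroup M] (f : Edge Fq → M)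
    (hf : ∀ e, f (reverse e) = -f e) (v : Vertex Fq) :
    ∑ᶠ (e : Edge Fq) (_ : terminus e = v), f e = -∑ᶠ (e : Edge Fq) (_ : origin e = v), f e := by
  classical
  have hinv : Function.Involutive (reverse : Edge Fq → Edge Fq) := reverse_reverse
  rw [← finsum_comp_equiv (hinv.toPerm _), ← finsum_neg_distrib]
  refine finsum_congr fun e => ?_
  have h : terminus (hinv.toPerm _ e) = origin e := by
    change origin (reverse (reverse e)) = _
    rw [reverse_reverse]
  by_cases he : origin e = v
  · rw [finsum_eq_if, finsum_eq_if, if_pos (h.trans he), if_pos he]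
    exact hf e
  · rw [finsum_eq_if, finsum_eq_if, if_neg (by rwa [h]), if_neg he, neg_zero]

theorem reverse_smul (g : GLinf Fq) (e : Edge Fq) : reverse (g • e) = g • reverse e := by
  induction e using QuotientGroup.induction_on with
  | H h =>
    change (QuotientGroup.mk (g * h * flipMatrix) : Edge Fq) =
      QuotientGroup.mk (g * (h * flipMatrix))
    rw [mul_assoc]

theorem origin_smul (g : GLinf Fq) (e : Edge Fq) : origin (g • e) = g • origin e := by
  induction e using QuotientGroup.induction_on with
  | H h => rfl

theorem finsum_origin_smul {M : Type*} [AddCommMonoid M] (f : Edge Fq → M) (g : GLinf Fq)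
    (v : Vertex Fq) :
    ∑ᶠ (e : Edge Fq) (_ : origin e = g • v), f e =
      ∑ᶠ (e : Edge Fq) (_ : origin e = v), f (g • e) := by
  classical
  rw [← finsum_comp_equiv (MulAction.toPerm g)]
  refine finsum_congr fun e => ?_
  rw [finsum_eq_if, finsum_eq_if]
  simp only [MulAction.toPerm_apply, origin_smul, smul_left_cancel_iff]

theorem finsum_origin_map [Finite Fq] {M N : Type*} [AddCommGroup M] [AddCommGroup N] (φ : M →+ N)
    (f : Edge Fq → M) (v : Vertex Fq) :
    ∑ᶠ (e : Edge Fq) (_ : origin e = v), φ (f e) =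
      φ (∑ᶠ (e : Edge Fq) (_ : origin e = v), f e) :=
  (φ.map_finsum_mem f (finite_origin_eq v)).symm

end TreeGeometry

/-! ### Generators of `GL₂(F_∞)` and connectedness of the tree. -/

section Generation

variable {Fq : Type*} [Field Fq] [DecidableEq (RatFunc Fq)]

theorem diagT_add (m n : ℤ) : diagT (Fq := Fq) (m + n) = diagT m * diagT n := by
  apply Units.ext
  rw [Units.val_mul, val_diagT, val_diagT, val_diagT, Matrix.mul_fin_two, zpow_add₀ tInf_ne_zero]
  simp

theorem diagT_zero : diagT (Fq := Fq) 0 = 1 := by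
  apply Units.ext
  rw [val_diagT, zpow_zero, Units.val_one, Matrix.one_fin_two]

theorem swap_mul_swap : swapMatrix * swapMatrix = (1 : GLinf Fq) := by
  apply Units.ext
  rw [Units.val_mul, val_swapMatrix, Matrix.mul_fin_two, Units.val_one, Matrix.one_fin_two]
  simp

theorem swap_mul_flip : swapMatrix * flipMatrix = diagT (Fq := Fq) (-1) := by
  apply Units.ext
  rw [Units.val_mul, val_swapMatrix, val_flipMatrix, Matrix.mul_fin_two, val_diagT]
  simp

theorem exists_v_eq_exp {x : Finf Fq} (hx : x ≠ 0) : ∃ n : ℤ, Valued.v x = exp n :=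
  ⟨log (Valued.v x), (exp_log ((Valuation.ne_zero_iff _).mpr hx)).symm⟩

theorem v_tInf_zpow (n : ℤ) : Valued.v (tInf Fq ^ n) = exp n := by
  rw [map_zpow₀, v_tInf, ← exp_zsmul]; simp

theorem diagMatrix_mem {x : Finf Fq} (hx : x ≠ 0) (h : Valued.v x = 1) :
    diagMatrix x hx ∈ GLAinf Fq := by
  refine mem_GLAinf ?_ ?_
  · intro i j
    rw [val_diagMatrix]
    fin_cases i <;> fin_cases j <;> simp [h]
  · rw [val_diagMatrix, Matrix.det_fin_two]; simp [h]

/-- `GL₂(F_∞)` is generated by the scalars, `GL₂(A_∞)` and the matrix `(0 1; π 0)`. -/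
theorem eq_top_of_GLAinf_le (S : Subgroup (GLinf Fq)) (hZ : scalars Fq ≤ S) (hK : GLAinf Fq ≤ S)
    (hf : flipMatrix ∈ S) : S = ⊤ := by
  have hd1 : diagT (-1) ∈ S := swap_mul_flip (Fq := Fq) ▸ S.mul_mem (hK swapMatrix_mem) hf
  have hd1' : diagT 1 ∈ S := by
    have h : diagT (Fq := Fq) 1 * diagT (-1) = 1 := by rw [← diagT_add]; exact diagT_zero
    rw [eq_inv_of_mul_eq_one_left h]
    exact S.inv_mem hd1
  have hd : ∀ n : ℤ, diagT n ∈ S := by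
    intro n
    induction n using Int.induction_on with
    | zero => rw [diagT_zero]; exact S.one_mem
    | succ n ih => rw [diagT_add]; exact S.mul_mem ih hd1'
    | pred n ih => rw [sub_eq_add_neg, diagT_add]; exact S.mul_mem ih hd1
  have hu : ∀ y : Finf Fq, upperUnipotent y ∈ S := by
    intro y
    obtain ⟨n, hn⟩ : ∃ n : ℤ, Valued.v y ≤ exp n := by
      by_cases hy : y = 0
      · exact ⟨0, by simp [hy]⟩
      · exact (exists_v_eq_exp hy).imp fun n h => h.le
    -- Conjugation by `diag(t ^ n, 1)` scales the entry, so a suitable `n` makes it integral.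
    have h : upperUnipotent y = diagT n * upperUnipotent (tInf Fq ^ (-n) * y) * diagT (-n) := by
      apply Units.ext
      rw [Units.val_mul, Units.val_mul, val_diagT, val_diagT, val_upperUnipotent,
        val_upperUnipotent, Matrix.mul_fin_two, Matrix.mul_fin_two]
      have := zpow_ne_zero n (tInf_ne_zero (Fq := Fq))
      simp [this]
    rw [h]
    refine S.mul_mem (S.mul_mem (hd n) (hK (upperUnipotent_mem ?_))) (hd _)
    rw [map_mul, v_tInf_zpow]
    calc _ ≤ exp (-n) * exp n := mul_le_mul_right hn _
      _ = 1 := by rw [← exp_add, neg_add_cancel, exp_zero]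
  have hx : ∀ (x : Finf Fq) (hx : x ≠ 0), diagMatrix x hx ∈ S := by
    intro x hx
    obtain ⟨n, hn⟩ := exists_v_eq_exp hx
    have h0 := zpow_ne_zero n (tInf_ne_zero (Fq := Fq))
    have hx' : x / tInf Fq ^ n ≠ 0 := div_ne_zero hx h0
    have h : diagMatrix x hx = diagT n * diagMatrix (x / tInf Fq ^ n) hx' := by
      apply Units.ext
      rw [Units.val_mul, val_diagT, val_diagMatrix, val_diagMatrix, Matrix.mul_fin_two]
      simp [mul_div_cancel₀ _ h0]
    rw [h]
    refine S.mul_mem (hd n) (hK (diagMatrix_mem hx' ?_))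
    rw [map_div₀, hn, v_tInf_zpow, div_self exp_ne_zero]
  have htri : ∀ g : GLinf Fq, g.val 1 0 = 0 → g ∈ S := by
    intro g hg
    have hdet := det_ne_zero g
    rw [Matrix.det_fin_two, hg, mul_zero, sub_zero] at hdet
    have ha := left_ne_zero_of_mul hdet
    have hd := right_ne_zero_of_mul hdet
    have h : g = scalarMatrix (g.val 1 1) hd * (upperUnipotent (g.val 0 1 / g.val 1 1) *
        diagMatrix (g.val 0 0 / g.val 1 1) (div_ne_zero ha hd)) := by
      apply Units.ext
      rw [Units.val_mul, Units.val_mul, val_scalarMatrix, val_upperUnipotent, val_diagMatrix,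
        Matrix.mul_fin_two, Matrix.mul_fin_two]
      conv_lhs => rw [Matrix.eta_fin_two g.val, hg]
      simp [mul_div_cancel₀ _ hd]
    rw [h]
    exact S.mul_mem (hZ (scalarMatrix_mem _ hd)) (S.mul_mem (hu _) (hx _ _))
  -- Iwasawa decomposition: an integral column operation clears the lower left entry. If that entry
  -- is the larger one of its row, the columns are swapped beforehand.
  have hle : ∀ g : GLinf Fq, Valued.v (g.val 1 0) ≤ Valued.v (g.val 1 1) → g ∈ S := by
    intro g hg
    have hd : g.val 1 1 ≠ 0 := by
      intro h0
      rw [h0, map_zero, le_zero_iff, Valuation.zero_iff] at hg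
      apply det_ne_zero g
      rw [Matrix.det_fin_two, hg, h0, mul_zero, mul_zero, sub_zero]
    have hvd : Valued.v (g.val 1 1) ≠ 0 := (Valuation.ne_zero_iff _).mpr hd
    have hl : lowerUnipotent (-(g.val 1 0 / g.val 1 1)) ∈ S := by
      refine hK (lowerUnipotent_mem ?_)
      rw [Valuation.map_neg, map_div₀]
      exact div_le_one_of_le₀ hg zero_le
    rw [← S.mul_mem_cancel_right hl]
    apply htri
    rw [Units.val_mul, val_lowerUnipotent, Matrix.mul_apply, Fin.sum_univ_two]
    simp [mul_div_cancel₀ _ hd]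
  refine (Subgroup.eq_top_iff' S).mpr fun g => ?_
  rcases le_total (Valued.v (g.val 1 0)) (Valued.v (g.val 1 1)) with h | h
  · exact hle g h
  · rw [← S.mul_mem_cancel_right (hK swapMatrix_mem)]
    apply hle
    simpa [Units.val_mul, val_swapMatrix, Matrix.mul_apply] using h

/-- The tree is connected: a set of edges that contains an edge and is closed under reversal and
under passing to an edge with the same origin contains all edges. -/
theorem edge_induction {P : Edge Fq → Prop} (e₀ : Edge Fq) (h₀ : P e₀)
    (hrev : ∀ e, P e → P (reverse e))
    (horigin : ∀ e e', P e → origin e' = origin e → P e') (e : Edge Fq) : P e := by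
  -- Right multiplication of representatives moves to neighbouring edges: `GL₂(A_∞)` keeps the
  -- origin and `flipMatrix` reverses. The elements that preserve `P` form a group containing
  -- generators, hence everything.
  let S : Subgroup (GLinf Fq) :=
    { carrier := {x | ∀ g : GLinf Fq, P (QuotientGroup.mk g) ↔ P (QuotientGroup.mk (g * x))}
      one_mem' := fun g => by rw [mul_one]
      mul_mem' := fun {x y} hx hy g => by rw [hx g, hy (g * x), mul_assoc]
      inv_mem' := fun {x} hx g => by rw [hx (g * x⁻¹), inv_mul_cancel_right] }
  have hS : S = ⊤ := by
    refine eq_top_of_GLAinf_le S ?_ ?_ ?_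
    · intro z hz g
      have : (QuotientGroup.mk (g * z) : Edge Fq) = QuotientGroup.mk g := by
        rw [eq_comm, QuotientGroup.eq, inv_mul_cancel_left]
        exact Subgroup.mem_sup_left hz
      rw [this]
    · intro k hk g
      exact ⟨fun h => horigin _ _ h (origin_mk_mul g hk),
        fun h => horigin _ _ h (origin_mk_mul g hk).symm⟩
    · intro g
      have h : (QuotientGroup.mk (g * flipMatrix) : Edge Fq) = reverse (QuotientGroup.mk g) := rfl
      rw [h]
      exact ⟨hrev _, fun h => by simpa only [reverse_reverse] using hrev _ h⟩
  induction e₀ using QuotientGroup.induction_on with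
  | H g =>
    induction e using QuotientGroup.induction_on with
    | H h =>
      have hmem : g⁻¹ * h ∈ S := hS ▸ Subgroup.mem_top _
      have := (hmem g).mp h₀
      rwa [mul_inv_cancel_left] at this

end Generation

/-! ### Unipotent matrices in `Γ₁(t)`. -/

section PolynomialMatrices

variable {Fq : Type*} [Field Fq]

/-- The congruence subgroup `Γ₁(t)`. -/
abbrev Gamma1T (Fq : Type*) [Field Fq] : Subgroup (Matrix.GeneralLinearGroup (Fin 2) Fq[X]) :=
  Gamma1 (Ideal.span {(X : Fq[X])})

/-- The matrix `(1 b; 0 1)` with polynomial entries. -/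
def upperPoly (b : Fq[X]) : Matrix.GeneralLinearGroup (Fin 2) Fq[X] where
  val := !![1, b; 0, 1]
  inv := !![1, -b; 0, 1]
  val_inv := by
    ext i j : 2
    fin_cases i <;> fin_cases j <;> simp [Matrix.mul_apply]
  inv_val := by
    ext i j : 2
    fin_cases i <;> fin_cases j <;> simp [Matrix.mul_apply]

/-- The matrix `(1 0; c 1)` with polynomial entries. -/
def lowerPoly (c : Fq[X]) : Matrix.GeneralLinearGroup (Fin 2) Fq[X] where
  val := !![1, 0; c, 1]
  inv := !![1, 0; -c, 1]
  val_inv := by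
    ext i j : 2
    fin_cases i <;> fin_cases j <;> simp [Matrix.mul_apply]
  inv_val := by
    ext i j : 2
    fin_cases i <;> fin_cases j <;> simp [Matrix.mul_apply]

theorem upperPoly_mem (b : Fq[X]) : upperPoly b ∈ Gamma1T Fq := by
  refine ⟨?_, ?_, ?_⟩ <;> simp [upperPoly]

theorem lowerPoly_mem (c : Fq[X]) : lowerPoly (X * c) ∈ Gamma1T Fq := by
  refine ⟨?_, ?_, ?_⟩ <;> simp [lowerPoly, Ideal.mem_span_singleton]

theorem upperPoly_zero : upperPoly (0 : Fq[X]) = 1 := by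
  apply Units.ext
  rw [Units.val_one, Matrix.one_fin_two]; rfl

theorem lowerPoly_zero : lowerPoly (0 : Fq[X]) = 1 := by
  apply Units.ext
  rw [Units.val_one, Matrix.one_fin_two]; rfl

theorem upperPoly_add (b b' : Fq[X]) : upperPoly (b + b') = upperPoly b * upperPoly b' := by
  apply Units.ext
  change !![1, b + b'; 0, 1] = !![1, b; 0, 1] * !![1, b'; 0, 1]
  rw [Matrix.mul_fin_two]
  simp [add_comm]

theorem lowerPoly_add (c c' : Fq[X]) : lowerPoly (c + c') = lowerPoly c * lowerPoly c' := by
  apply Units.ext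
  change !![1, 0; c + c', 1] = !![1, 0; c, 1] * !![1, 0; c', 1]
  rw [Matrix.mul_fin_two]
  simp

theorem ne_zero_of_sub_one_mem {p : Fq[X]} (h : p - 1 ∈ Ideal.span {(X : Fq[X])}) : p ≠ 0 := by
  rintro rfl
  rw [Ideal.mem_span_singleton, zero_sub, dvd_neg] at h
  exact not_isUnit_X (isUnit_of_dvd_one h)

end PolynomialMatrices

/-! ### The standard apartment as a fundamental domain for `Γ₁(t)`. -/

section Apartment

variable {Fq : Type*} [Field Fq] [DecidableEq (RatFunc Fq)]

/-- The map `GL₂(𝔽_q[t]) → GL₂(F_∞)`. -/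
abbrev toInf : Matrix.GeneralLinearGroup (Fin 2) Fq[X] →* GLinf Fq :=
  Matrix.GeneralLinearGroup.map (ofPoly Fq)

theorem toInf_upperPoly (b : Fq[X]) : toInf (upperPoly b) = upperUnipotent (ofPoly Fq b) := by
  ext i j
  change ofPoly Fq (!![1, b; 0, 1] i j) = !![1, ofPoly Fq b; 0, 1] i j
  fin_cases i <;> fin_cases j <;> simp

theorem toInf_lowerPoly (c : Fq[X]) : toInf (lowerPoly c) = lowerUnipotent (ofPoly Fq c) := by
  ext i j
  change ofPoly Fq (!![1, 0; c, 1] i j) = !![1, 0; ofPoly Fq c, 1] i j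
  fin_cases i <;> fin_cases j <;> simp

/-- The edges `diag(t ^ n, 1) (0 1; 1 0)`, which form an oriented apartment. -/
def stdEdge (n : ℤ) : Edge Fq := QuotientGroup.mk (diagT n * swapMatrix)

theorem stdEdge_zero : stdEdge 0 = eBar Fq := by
  rw [stdEdge, diagT_zero, one_mul]; rfl

theorem reverse_stdEdge (n : ℤ) :
    reverse (stdEdge n) = (QuotientGroup.mk (diagT (n - 1)) : Edge Fq) := by
  change (QuotientGroup.mk (diagT n * swapMatrix * flipMatrix) : Edge Fq) = _
  rw [mul_assoc, swap_mul_flip, ← diagT_add]; rfl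

theorem origin_stdEdge (n : ℤ) : origin (stdEdge n) = (QuotientGroup.mk (diagT n) : Vertex Fq) :=
  origin_mk_mul _ swapMatrix_mem

theorem origin_reverse_stdEdge (n : ℤ) :
    origin (reverse (stdEdge n)) = (QuotientGroup.mk (diagT (n - 1)) : Vertex Fq) := by
  rw [reverse_stdEdge]; rfl

/-- Moving a unipotent matrix across `diag(t ^ n, 1)` rescales its entry. For constant `x` and `n <
0` the new entry is a polynomial divisible by `t`, so the translating matrix comes from `Γ₁(t)`. -/
theorem mk_diagT_mul_lower (n : ℤ) (x : Finf Fq) :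
    (QuotientGroup.mk (diagT n * lowerUnipotent x) : Edge Fq) =
      lowerUnipotent (x * tInf Fq ^ (-n)) • reverse (stdEdge (n + 1)) := by
  rw [reverse_stdEdge, add_sub_cancel_right]
  change _ = QuotientGroup.mk (lowerUnipotent (x * tInf Fq ^ (-n)) * diagT n)
  congr 1
  apply Units.ext
  have := zpow_ne_zero n (tInf_ne_zero (Fq := Fq))
  rw [Units.val_mul, Units.val_mul, val_diagT, val_lowerUnipotent, val_lowerUnipotent,
    Matrix.mul_fin_two, Matrix.mul_fin_two]
  simp [this]

/-- The counterpart for the other half of the apartment: for constant `x` and `n ≥ 0` the upper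
right entry is a polynomial, with no divisibility needed. -/
theorem mk_diagT_swap_mul_lower (n : ℤ) (x : Finf Fq) :
    (QuotientGroup.mk (diagT n * swapMatrix * lowerUnipotent x) : Edge Fq) =
      upperUnipotent (x * tInf Fq ^ n) • stdEdge n := by
  change _ = QuotientGroup.mk (upperUnipotent (x * tInf Fq ^ n) * (diagT n * swapMatrix))
  congr 1
  apply Units.ext
  rw [Units.val_mul, Units.val_mul, Units.val_mul, Units.val_mul, val_diagT, val_lowerUnipotent,
    val_upperUnipotent, val_swapMatrix, Matrix.mul_fin_two, Matrix.mul_fin_two, Matrix.mul_fin_two]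
  simp [mul_comm]

theorem mk_diagT_swap_mul_swap (n : ℤ) :
    (QuotientGroup.mk (diagT n * swapMatrix * swapMatrix) : Edge Fq) =
      reverse (stdEdge (n + 1)) := by
  rw [reverse_stdEdge, add_sub_cancel_right, mul_assoc, swap_mul_swap, mul_one]

theorem ofPoly_C_mul_X_pow (β : Fq) (n : ℕ) :
    ofPoly Fq (C β * X ^ n) = ofPoly Fq (C β) * tInf Fq ^ n := by
  rw [map_mul, map_pow]; rfl

/-- The edges starting at a vertex `diag(t ^ n, 1)`, `n ≥ 0`. -/
theorem finsum_origin_of_nonneg [Fintype Fq] {M : Type*} [AddCommMonoid M] (f : Edge Fq → M)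
    (n : ℕ) :
    ∑ᶠ (e : Edge Fq) (_ : origin e = QuotientGroup.mk (diagT (n : ℤ))), f e =
      f (reverse (stdEdge (n + 1))) +
        ∑ β : Fq, f (toInf (upperPoly (C β * X ^ n)) • stdEdge n) := by
  -- The same vertex is represented by `diag(t ^ n, 1) (0 1; 1 0)`, so that its outgoing edges
  -- become translates by upper instead of lower unipotent matrices.
  rw [← origin_stdEdge]
  change ∑ᶠ (e : Edge Fq) (_ : origin e = QuotientGroup.mk (diagT (n : ℤ) * swapMatrix)), f e = _
  rw [finsum_origin_eq, mk_diagT_swap_mul_swap]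
  simp only [mk_diagT_swap_mul_lower, toInf_upperPoly, ofPoly_C_mul_X_pow, zpow_natCast]

/-- The edges starting at a vertex `diag(t ^ n, 1)`, `n < 0`. -/
theorem finsum_origin_of_neg [Fintype Fq] {M : Type*} [AddCommMonoid M] (f : Edge Fq → M)
    (n : ℕ) :
    ∑ᶠ (e : Edge Fq) (_ : origin e = QuotientGroup.mk (diagT (-(n : ℤ) - 1))), f e =
      f (stdEdge (-(n : ℤ) - 1)) +
        ∑ β : Fq, f (toInf (lowerPoly (X * (C β * X ^ n))) • reverse (stdEdge (-n))) := by
  rw [finsum_origin_eq]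
  congr 1
  refine Finset.sum_congr rfl fun β _ => ?_
  rw [mk_diagT_mul_lower, toInf_lowerPoly, sub_add_cancel, mul_left_comm, ← pow_succ',
    ofPoly_C_mul_X_pow]
  congr 4
  rw [neg_sub, sub_neg_eq_add, add_comm, ← zpow_natCast]; push_cast; rfl

/-- Every edge is a `Γ₁(t)`-translate of an edge of the standard apartment. -/
theorem exists_smul_stdEdge (e : Edge Fq) : ∃ γ ∈ Gamma1T Fq, ∃ n : ℤ,
    e = toInf γ • stdEdge n ∨ e = toInf γ • reverse (stdEdge n) := by
  -- The claim for edges leaving the apartment suffices: by connectedness the property then spreads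
  -- along translates to the whole tree.
  have hvert : ∀ (n : ℤ) (e : Edge Fq), origin e = QuotientGroup.mk (diagT n) →
      ∃ γ ∈ Gamma1T Fq, ∃ n : ℤ, e = toInf γ • stdEdge n ∨ e = toInf γ • reverse (stdEdge n) := by
    intro n e he
    rcases le_or_gt 0 n with hn | hn
    · lift n to ℕ using hn
      rw [← origin_stdEdge] at he
      rcases origin_eq_mk (g := diagT (n : ℤ) * swapMatrix) he with h | ⟨β, h⟩
      · exact ⟨1, one_mem _, n + 1, Or.inr (by rw [h, mk_diagT_swap_mul_swap, map_one, one_smul])⟩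
      · refine ⟨_, upperPoly_mem (C β * X ^ n), n, Or.inl ?_⟩
        rw [h, mk_diagT_swap_mul_lower, toInf_upperPoly, ofPoly_C_mul_X_pow, zpow_natCast]
    · obtain ⟨m, rfl⟩ : ∃ m : ℕ, n = -(m : ℤ) - 1 := ⟨(-n - 1).toNat, by omega⟩
      rcases origin_eq_mk he with h | ⟨β, h⟩
      · exact ⟨1, one_mem _, _, Or.inl (by rw [h, map_one, one_smul]; rfl)⟩
      · refine ⟨_, lowerPoly_mem (C β * X ^ m), -m, Or.inr ?_⟩
        rw [h, mk_diagT_mul_lower, toInf_lowerPoly, sub_add_cancel, mul_left_comm, ← pow_succ',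
          ofPoly_C_mul_X_pow]
        congr 3
        rw [neg_sub, sub_neg_eq_add, add_comm, ← zpow_natCast]; push_cast; rfl
  refine edge_induction (P := fun e => ∃ γ ∈ Gamma1T Fq, ∃ n : ℤ,
    e = toInf γ • stdEdge n ∨ e = toInf γ • reverse (stdEdge n)) (stdEdge 0)
    ⟨1, one_mem _, 0, Or.inl (by rw [map_one, one_smul])⟩ ?_ ?_ e
  · rintro e ⟨γ, hγ, n, rfl | rfl⟩
    · exact ⟨γ, hγ, n, Or.inr (reverse_smul _ _)⟩
    · exact ⟨γ, hγ, n, Or.inl (by rw [reverse_smul, reverse_reverse])⟩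
  · have key : ∀ (γ) (_ : γ ∈ Gamma1T Fq) (n : ℤ) (e' : Edge Fq),
        origin e' = toInf γ • QuotientGroup.mk (diagT n) → ∃ γ ∈ Gamma1T Fq, ∃ n : ℤ,
          e' = toInf γ • stdEdge n ∨ e' = toInf γ • reverse (stdEdge n) := by
      intro γ hγ n e' he'
      obtain ⟨δ, hδ, l, h⟩ := hvert n ((toInf γ)⁻¹ • e') (by rw [origin_smul, he', inv_smul_smul])
      refine ⟨γ * δ, mul_mem hγ hδ, l, ?_⟩
      rw [map_mul, mul_smul, mul_smul]
      exact h.imp (fun h => by rw [← h, smul_inv_smul]) fun h => by rw [← h, smul_inv_smul]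
    rintro e e' ⟨γ, hγ, n, rfl | rfl⟩ he'
    · exact key γ hγ n e' (by rw [he', origin_smul, origin_stdEdge])
    · exact key γ hγ (n - 1) e' (by rw [he', origin_smul, origin_reverse_stdEdge])

theorem exists_origin_eq_smul (v : Vertex Fq) :
    ∃ γ ∈ Gamma1T Fq, ∃ n : ℤ, v = toInf γ • QuotientGroup.mk (diagT n) := by
  induction v using QuotientGroup.induction_on with
  | H g =>
    obtain ⟨γ, hγ, n, h | h⟩ := exists_smul_stdEdge (QuotientGroup.mk g)
    · refine ⟨γ, hγ, n, ?_⟩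
      have := congrArg origin h
      rwa [origin_smul, origin_stdEdge] at this
    · refine ⟨γ, hγ, n - 1, ?_⟩
      have := congrArg origin h
      rwa [origin_smul, origin_reverse_stdEdge] at this

theorem v_ofPoly_lt_one {p : Fq[X]} (h : Valued.v (ofPoly Fq p) < 1) : p = 0 := by
  by_contra hp
  rw [v_ofPoly hp, ← exp_zero, exp_lt_exp] at h
  omega

theorem one_le_v_ofPoly {p : Fq[X]} (h : p ≠ 0) : 1 ≤ Valued.v (ofPoly Fq p) :=
  not_lt.mp fun hlt => h (v_ofPoly_lt_one hlt)

theorem degree_lt_of_v_lt {p : Fq[X]} {n : ℕ} (h : Valued.v (ofPoly Fq p) < exp (n : ℤ)) :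
    p.degree < n := by
  by_cases hp : p = 0
  · rw [hp, degree_zero]; exact WithBot.bot_lt_coe _
  · rw [v_ofPoly hp, exp_lt_exp] at h
    rw [← natDegree_lt_iff_degree_lt hp]
    exact_mod_cast h

/-- Absolute value 1 makes `p` a constant, and the congruence modulo `t` fixes that constant. -/
theorem eq_one_of_sub_one_mem {p : Fq[X]} (h : p - 1 ∈ Ideal.span {(X : Fq[X])})
    (hv : Valued.v (ofPoly Fq p) = 1) : p = 1 := by
  have hp := ne_zero_of_sub_one_mem h
  rw [v_ofPoly hp, ← exp_zero, exp_inj] at hv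
  obtain ⟨a, rfl⟩ := natDegree_eq_zero.mp (Int.natCast_eq_zero.mp hv)
  rw [Ideal.mem_span_singleton, X_dvd_iff] at h
  simp only [coeff_sub, coeff_C_zero, coeff_one_zero] at h
  rw [sub_eq_zero.mp h, C_1]

theorem v_det_eq_one (γ : Matrix.GeneralLinearGroup (Fin 2) Fq[X]) :
    Valued.v (ofPoly Fq (γ.val 0 0) * ofPoly Fq (γ.val 1 1) -
      ofPoly Fq (γ.val 0 1) * ofPoly Fq (γ.val 1 0)) = 1 := by
  rw [← map_mul, ← map_mul, ← map_sub, ← Matrix.det_fin_two]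
  have hu : IsUnit γ.val.det := (Matrix.isUnit_iff_isUnit_det _).mp γ.isUnit
  rw [v_ofPoly hu.ne_zero, natDegree_eq_zero_of_isUnit hu]; simp

theorem val_toInf (γ : Matrix.GeneralLinearGroup (Fin 2) Fq[X]) :
    (toInf γ).val = !![ofPoly Fq (γ.val 0 0), ofPoly Fq (γ.val 0 1);
      ofPoly Fq (γ.val 1 0), ofPoly Fq (γ.val 1 1)] := by
  ext i j
  change ofPoly Fq (γ.val i j) = _
  fin_cases i <;> fin_cases j <;> rfl

/-- Distinct edges of the standard apartment are inequivalent under `Γ₁(t)`, and their stabilisers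
are unipotent. -/
theorem smul_stdEdge_eq {γ : Matrix.GeneralLinearGroup (Fin 2) Fq[X]} (hγ : γ ∈ Gamma1T Fq)
    {n n' : ℤ} (h : toInf γ • stdEdge n = (stdEdge n' : Edge Fq)) :
    n = n' ∧ (∀ l : ℕ, n = l → ∃ b : Fq[X], b.degree < l ∧ γ = upperPoly b) ∧
      (∀ l : ℕ, n = -l → ∃ c : Fq[X], c.degree < l ∧ γ = lowerPoly (X * c)) := by
  have h' : (QuotientGroup.mk (toInf γ * (diagT n * swapMatrix)) : Edge Fq) =
      QuotientGroup.mk (diagT n' * swapMatrix) := h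
  obtain ⟨z, hz, k, hk, he⟩ := mk_eq_mk_iff.mp h'.symm
  obtain ⟨h00, h01, h10, h11⟩ := exists_of_mem_iwahori hk
  have hval := congrArg Units.val he
  simp only [Units.val_mul, val_swapMatrix, val_scalarMatrix, val_diagT, val_toInf] at hval
  rw [Matrix.eta_fin_two k.val] at hval
  simp only [Matrix.mul_fin_two] at hval
  have e00 := congrFun (congrFun hval 0) 0
  have e01 := congrFun (congrFun hval 0) 1
  have e10 := congrFun (congrFun hval 1) 0
  have e11 := congrFun (congrFun hval 1) 1
  simp at e00 e01 e10 e11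
  obtain ⟨r, hr⟩ := exists_v_eq_exp hz
  have hdet := v_det_eq_one γ
  obtain ⟨ha, hd, hc⟩ := hγ
  have v00 := congrArg Valued.v e00
  have v01 := congrArg Valued.v e01
  have v10 := congrArg Valued.v e10
  have v11 := congrArg Valued.v e11
  rw [map_mul, map_mul, v_tInf_zpow, hr] at v00
  rw [map_mul, map_mul, map_mul, v_tInf_zpow, v_tInf_zpow, hr, h11, mul_one, ← exp_add] at v01
  rw [map_mul, hr, h00, mul_one] at v10
  rw [map_mul, map_mul, v_tInf_zpow, hr] at v11
  have va : Valued.v (ofPoly Fq (γ.val 0 0)) = exp (n' + r - n) := by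
    rw [exp_sub, ← v01, mul_div_cancel_right₀ _ exp_ne_zero]
  have hn0 : 0 ≤ n' + r - n := by
    rw [← exp_le_exp, ← va, exp_zero]; exact one_le_v_ofPoly (ne_zero_of_sub_one_mem ha)
  have hr0 : 0 ≤ r := by
    rw [← exp_le_exp, ← v10, exp_zero]; exact one_le_v_ofPoly (ne_zero_of_sub_one_mem hd)
  -- The diagonal product dominates the determinant, which is a unit. The degrees `n' + r - n` and
  -- `r` of the diagonal entries are nonnegative and add up to 0, so both vanish and `n = n'`.
  have hlt : Valued.v (ofPoly Fq (γ.val 0 1) * ofPoly Fq (γ.val 1 0)) <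
      Valued.v (ofPoly Fq (γ.val 0 0) * ofPoly Fq (γ.val 1 1)) := by
    rw [← mul_lt_mul_iff_left₀ (exp_pos (a := n))]
    calc _ = exp (n' + r + r) * (Valued.v (k.val 1 0) * Valued.v (k.val 0 1)) := by
          rw [map_mul, mul_assoc, v11, v00, exp_add, exp_add]; ac_rfl
      _ < exp (n' + r + r) * 1 := by
          refine mul_lt_mul_of_pos_left ?_ exp_pos
          exact (mul_le_of_le_one_right' h01).trans_lt h10
      _ = _ := by rw [map_mul, va, v10, ← exp_add, ← exp_add, mul_one]; congr 1; omega
  rw [Valuation.map_sub_eq_of_lt_left _ hlt, map_mul, va, v10, ← exp_add, ← exp_zero,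
    exp_inj] at hdet
  obtain rfl : r = 0 := by omega
  obtain rfl : n = n' := by omega
  rw [exp_zero] at v10
  rw [add_zero, sub_self, exp_zero] at va
  rw [exp_zero, one_mul] at v00 v11
  have ha1 := eq_one_of_sub_one_mem ha va
  have hd1 := eq_one_of_sub_one_mem hd v10
  have hb : Valued.v (ofPoly Fq (γ.val 0 1)) < exp n := by
    rw [v00]; exact mul_lt_of_lt_one_right exp_pos h10
  obtain ⟨c, hc⟩ := Ideal.mem_span_singleton.mp hc
  -- The factor `X` in the lower left entry accounts for the `+ 1`. This rules out `c ≠ 0` when `n ≥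
  -- 0` and gives degree `< l` when `n = -l`.
  have hdeg : c ≠ 0 → (c.natDegree : ℤ) + 1 + n ≤ 0 := by
    intro hc0
    rw [hc, v_ofPoly (mul_ne_zero X_ne_zero hc0), ← exp_add, natDegree_X_mul hc0] at v11
    rw [← v11, ← exp_zero, exp_le_exp] at h01
    exact_mod_cast h01
  refine ⟨rfl, ?_, ?_⟩
  · rintro l rfl
    refine ⟨γ.val 0 1, degree_lt_of_v_lt hb, Units.ext ?_⟩
    have hc0 : c = 0 := by
      by_contra hc0
      have := hdeg hc0
      omega
    rw [Matrix.eta_fin_two γ.val, ha1, hd1, hc, hc0, mul_zero]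
    rfl
  · rintro l rfl
    refine ⟨c, ?_, Units.ext ?_⟩
    · by_cases hc0 : c = 0
      · rw [hc0, degree_zero]; exact WithBot.bot_lt_coe _
      · rw [← natDegree_lt_iff_degree_lt hc0]
        have := hdeg hc0
        omega
    · have hb0 : γ.val 0 1 = 0 := by
        refine v_ofPoly_lt_one (hb.trans_le ?_)
        rw [← exp_zero, exp_le_exp]; omega
      rw [Matrix.eta_fin_two γ.val, ha1, hd1, hc, hb0]
      rfl

/-- No edge of the standard apartment is equivalent to a reversed one under `Γ₁(t)`. -/
theorem smul_stdEdge_ne_reverse {γ : Matrix.GeneralLinearGroup (Fin 2) Fq[X]}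
    (hγ : γ ∈ Gamma1T Fq) (n n' : ℤ) : toInf γ • stdEdge n ≠ (reverse (stdEdge n') : Edge Fq) := by
  intro h
  rw [reverse_stdEdge] at h
  generalize n' - 1 = N at h
  have h' : (QuotientGroup.mk (toInf γ * (diagT n * swapMatrix)) : Edge Fq) =
      QuotientGroup.mk (diagT N) := h
  obtain ⟨z, hz, k, hk, he⟩ := mk_eq_mk_iff.mp h'.symm
  obtain ⟨h00, h01, h10, h11⟩ := exists_of_mem_iwahori hk
  have hval := congrArg Units.val he
  simp only [Units.val_mul, val_swapMatrix, val_scalarMatrix, val_diagT, val_toInf] at hval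
  rw [Matrix.eta_fin_two k.val] at hval
  simp only [Matrix.mul_fin_two] at hval
  have e00 := congrFun (congrFun hval 0) 0
  have e01 := congrFun (congrFun hval 0) 1
  have e10 := congrFun (congrFun hval 1) 0
  have e11 := congrFun (congrFun hval 1) 1
  simp at e00 e01 e10 e11
  have hdet := v_det_eq_one γ
  obtain ⟨ha, hd, hc⟩ := hγ
  -- Now the antidiagonal product dominates the unit determinant, so the diagonal product would have
  -- absolute value below 1. But the diagonal entries are nonzero polynomials, being `≡ 1` modulo
  -- `t`.
  have hlt : Valued.v (ofPoly Fq (γ.val 0 0) * ofPoly Fq (γ.val 1 1)) <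
      Valued.v (ofPoly Fq (γ.val 0 1) * ofPoly Fq (γ.val 1 0)) := by
    have h0 : (0 : ℤᵐ⁰) < Valued.v (tInf Fq ^ N * z * z) :=
      (Valuation.pos_iff _).mpr
        (mul_ne_zero (mul_ne_zero (zpow_ne_zero _ (tInf_ne_zero (Fq := Fq))) hz) hz)
    have el : ofPoly Fq (γ.val 0 0) * ofPoly Fq (γ.val 1 1) * tInf Fq ^ n =
        tInf Fq ^ N * z * z * (k.val 0 1 * k.val 1 0) := by
      linear_combination (ofPoly Fq (γ.val 1 1)) * e01 + tInf Fq ^ N * (z * k.val 0 1) * e10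
    have er : ofPoly Fq (γ.val 0 1) * ofPoly Fq (γ.val 1 0) * tInf Fq ^ n =
        tInf Fq ^ N * z * z * (k.val 0 0 * k.val 1 1) := by
      linear_combination (ofPoly Fq (γ.val 1 0)) * tInf Fq ^ n * e00 +
        tInf Fq ^ N * (z * k.val 0 0) * e11
    rw [← mul_lt_mul_iff_left₀ (exp_pos (a := n)), ← v_tInf_zpow (Fq := Fq) n,
      ← Valuation.map_mul, ← Valuation.map_mul, el, er, Valuation.map_mul _ _ (k.val 0 1 * k.val 1 0),
      Valuation.map_mul _ _ (k.val 0 0 * k.val 1 1)]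
    refine mul_lt_mul_of_pos_left ?_ h0
    rw [map_mul, map_mul, h00, h11, one_mul]
    exact (mul_le_of_le_one_left' h01).trans_lt h10
  rw [Valuation.map_sub_eq_of_lt_right _ hlt] at hdet
  rw [hdet] at hlt
  refine absurd hlt (not_lt.mpr ?_)
  rw [map_mul]
  exact one_le_mul (one_le_v_ofPoly (ne_zero_of_sub_one_mem ha))
    (one_le_v_ofPoly (ne_zero_of_sub_one_mem hd))

end Apartment

/-! ### Iterated sums over polynomials of bounded degree. -/

section UnipotentSums

variable {Fq : Type*} [Field Fq] [Fintype Fq]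
variable {L M : Type*} [Field L] [AddCommGroup M] [Module L M]

/-- The sum of `φ b x` over the polynomials `b` of degree `< n`, formed one coefficient at a time. -/
def unipotentSum (φ : Fq[X] → M →ₗ[L] M) (x : M) : ℕ → M
  | 0 => x
  | n + 1 => ∑ β : Fq, φ (C β * X ^ n) (unipotentSum φ x n)

/-- Translation by `b` permutes the polynomials of degree `< n`. In the induction, the part of `b`
below the top coefficient is absorbed by the inner sum, and the top coefficient shifts the outer
summation variable. -/
theorem unipotentSum_invariant (φ : Fq[X] → M →ₗ[L] M) (h0 : ∀ x, φ 0 x = x)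
    (hadd : ∀ a b x, φ (a + b) x = φ a (φ b x)) (x : M) (n : ℕ) :
    ∀ b : Fq[X], b.degree < n → φ b (unipotentSum φ x n) = unipotentSum φ x n := by
  induction n with
  | zero =>
    intro b hb
    rw [degree_lt_iff_coeff_zero] at hb
    have : b = 0 := by ext i; simpa using hb i (Nat.zero_le i)
    rw [this, h0]
  | succ n ih =>
    intro b hb
    rw [degree_lt_iff_coeff_zero] at hb
    have hb' : (b - C (b.coeff n) * X ^ n).degree < (n : WithBot ℕ) := by
      rw [degree_lt_iff_coeff_zero]
      intro i hi
      rw [coeff_sub, coeff_C_mul_X_pow]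
      rcases eq_or_lt_of_le hi with rfl | hlt
      · simp
      · rw [hb i hlt, if_neg hlt.ne', sub_zero]
    have key : ∀ β : Fq, φ b (φ (C β * X ^ n) (unipotentSum φ x n)) =
        φ (C (b.coeff n + β) * X ^ n) (unipotentSum φ x n) := by
      intro β
      conv_rhs => rw [← ih _ hb']
      rw [← hadd, ← hadd]
      congr 2
      rw [C_add]; ring
    change φ b (∑ β : Fq, φ (C β * X ^ n) (unipotentSum φ x n)) =
      ∑ β : Fq, φ (C β * X ^ n) (unipotentSum φ x n)
    rw [map_sum]
    simp only [key]
    exact Fintype.sum_equiv (Equiv.addLeft (b.coeff n)) _ _ fun β => rfl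

end UnipotentSums

/-! ### The action on `Hom(V(k,m), L)`. -/

section Action

variable {Fq : Type*} [Field Fq] [DecidableEq (RatFunc Fq)]
variable (L : Type*) [Field L] [Algebra (Finf Fq) L]

/-- Substitution reverses products. Dualising reverses them again, so `act` is a left action. -/
theorem subst_mul (γ δ : GLinf Fq) : subst L (γ * δ) = (subst L δ).comp (subst L γ) := by
  apply MvPolynomial.algHom_ext
  intro i
  simp only [subst, AlgHom.comp_apply, MvPolynomial.aeval_X, Units.val_mul, Matrix.mul_apply,
    Fin.sum_univ_two, map_add, map_mul, MvPolynomial.aeval_C, MvPolynomial.algebraMap_eq]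
  ring

theorem subst_one : subst L (1 : GLinf Fq) = AlgHom.id L _ := by
  apply MvPolynomial.algHom_ext
  intro i
  fin_cases i <;> simp [subst]

theorem act_mul (k : ℕ) (m : ℤ) (γ δ : GLinf Fq) (ω : Module.Dual L (V L k)) :
    act L k m (γ * δ) ω = act L k m γ (act L k m δ ω) := by
  have hs : ∀ p, substV L k (γ * δ) p = substV L k δ (substV L k γ p) := by
    intro p
    apply Subtype.ext
    change subst L (γ * δ) p = subst L δ (subst L γ p)
    rw [subst_mul]; rfl
  ext p
  simp only [act, LinearMap.smul_apply, LinearMap.dualMap_apply, hs, Units.val_mul, Matrix.det_mul,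
    map_mul, mul_zpow, smul_eq_mul]
  ring

theorem act_one (k : ℕ) (m : ℤ) (ω : Module.Dual L (V L k)) :
    act L k m (1 : GLinf Fq) ω = ω := by
  have hs : ∀ p, substV L k (1 : GLinf Fq) p = p := by
    intro p
    apply Subtype.ext
    change subst L (1 : GLinf Fq) p = p
    rw [subst_one]; rfl
  ext p
  simp [act, hs]

end Action

/-! ### Harmonic cocycles and their values at `ē`. -/

section Construction

variable {Fq : Type*} [Field Fq] [Fintype Fq] [DecidableEq (RatFunc Fq)]
variable {L : Type*} [Field L] [Algebra (Finf Fq) L] {k : ℕ} {m : ℤ}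

/-- The action of the upper triangular unipotent matrices with polynomial entries. -/
abbrev upperAct (m : ℤ) (b : Fq[X]) : Module.Dual L (V L k) →ₗ[L] Module.Dual L (V L k) :=
  act L k m (toInf (upperPoly b))

/-- The action of the lower triangular unipotent matrices in `Γ₁(t)`. -/
abbrev lowerAct (m : ℤ) (c : Fq[X]) : Module.Dual L (V L k) →ₗ[L] Module.Dual L (V L k) :=
  act L k m (toInf (lowerPoly (X * c)))

/-- The value on `stdEdge n` of the harmonic cocycle with value `ω` on `ē`. -/
def stdValue (m : ℤ) (ω : Module.Dual L (V L k)) (n : ℤ) : Module.Dual L (V L k) :=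
  if 0 ≤ n then unipotentSum (Fq := Fq) (upperAct m) ω n.toNat
  else unipotentSum (Fq := Fq) (lowerAct m) ω (-n).toNat

theorem stdValue_natCast (ω : Module.Dual L (V L k)) (n : ℕ) :
    stdValue (Fq := Fq) m ω n = unipotentSum (Fq := Fq) (upperAct m) ω n := by
  simp [stdValue]

theorem stdValue_neg_natCast (ω : Module.Dual L (V L k)) (n : ℕ) :
    stdValue (Fq := Fq) m ω (-n) = unipotentSum (Fq := Fq) (lowerAct m) ω n := by
  rcases Nat.eq_zero_or_pos n with rfl | hn
  · simp [stdValue, unipotentSum]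
  · rw [stdValue, if_neg (by omega), neg_neg, Int.toNat_natCast]

/-- The compatibility that makes an equivariant extension possible: the value at `stdEdge n` is a
sum over the same range of unipotent matrices that contains the stabiliser of that edge. -/
theorem stdValue_invariant (ω : Module.Dual L (V L k)) {γ : Matrix.GeneralLinearGroup (Fin 2) Fq[X]}
    (hγ : γ ∈ Gamma1T Fq) {n n' : ℤ} (h : toInf γ • stdEdge n = (stdEdge n' : Edge Fq)) :
    act L k m (toInf γ) (stdValue (Fq := Fq) m ω n) = stdValue (Fq := Fq) m ω n' := by
  obtain ⟨rfl, h1, h2⟩ := smul_stdEdge_eq hγ h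
  rcases le_total 0 n with hn | hn
  · lift n to ℕ using hn
    obtain ⟨b, hb, rfl⟩ := h1 n rfl
    rw [stdValue_natCast]
    refine unipotentSum_invariant (upperAct m) (fun x => ?_) (fun a b x => ?_) ω n b hb
    · rw [upperAct, upperPoly_zero, map_one, act_one]
    · rw [upperAct, upperPoly_add, map_mul, act_mul]
  · obtain ⟨l, rfl⟩ : ∃ l : ℕ, n = -l := ⟨(-n).toNat, by omega⟩
    obtain ⟨b, hb, rfl⟩ := h2 l rfl
    rw [stdValue_neg_natCast]
    refine unipotentSum_invariant (lowerAct m) (fun x => ?_) (fun a b x => ?_) ω l b hb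
    · rw [lowerAct, mul_zero, lowerPoly_zero, map_one, act_one]
    · rw [lowerAct, mul_add, lowerPoly_add, map_mul, act_mul]

open scoped Classical in
/-- The harmonic cocycle for `Γ₁(t)` with value `ω` on `ē`. -/
def cocycle (m : ℤ) (ω : Module.Dual L (V L k)) (e : Edge Fq) : Module.Dual L (V L k) :=
  if h : ∃ p : Gamma1T Fq × ℤ, e = toInf p.1.1 • stdEdge p.2 then
    act L k m (toInf h.choose.1.1) (stdValue (Fq := Fq) m ω h.choose.2)
  else if h : ∃ p : Gamma1T Fq × ℤ, e = toInf p.1.1 • reverse (stdEdge p.2) then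
    -act L k m (toInf h.choose.1.1) (stdValue (Fq := Fq) m ω h.choose.2)
  -- Never reached, by `exists_smul_stdEdge`.
  else 0

/-- Makes `cocycle` independent of the translate chosen in its definition. -/
theorem act_stdValue_eq (ω : Module.Dual L (V L k))
    {γ γ' : Matrix.GeneralLinearGroup (Fin 2) Fq[X]} (hγ : γ ∈ Gamma1T Fq) (hγ' : γ' ∈ Gamma1T Fq)
    {n n' : ℤ} (h : toInf γ • stdEdge n = (toInf γ' • stdEdge n' : Edge Fq)) :
    act L k m (toInf γ) (stdValue (Fq := Fq) m ω n) =
      act L k m (toInf γ') (stdValue (Fq := Fq) m ω n') := by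
  have h' : toInf (γ'⁻¹ * γ) • stdEdge n = (stdEdge n' : Edge Fq) := by
    rw [map_mul, map_inv, mul_smul, h, inv_smul_smul]
  rw [← stdValue_invariant ω (mul_mem (inv_mem hγ') hγ) h', ← act_mul, ← map_mul,
    mul_inv_cancel_left]

theorem cocycle_smul_stdEdge (ω : Module.Dual L (V L k))
    {γ : Matrix.GeneralLinearGroup (Fin 2) Fq[X]} (hγ : γ ∈ Gamma1T Fq) (n : ℤ) :
    cocycle m ω (toInf γ • stdEdge n : Edge Fq) =
      act L k m (toInf γ) (stdValue (Fq := Fq) m ω n) := by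
  have h : ∃ p : Gamma1T Fq × ℤ, (toInf γ • stdEdge n : Edge Fq) = toInf p.1.1 • stdEdge p.2 :=
    ⟨(⟨γ, hγ⟩, n), rfl⟩
  rw [cocycle, dif_pos h]
  exact act_stdValue_eq ω h.choose.1.2 hγ h.choose_spec.symm

theorem cocycle_smul_reverse_stdEdge (ω : Module.Dual L (V L k))
    {γ : Matrix.GeneralLinearGroup (Fin 2) Fq[X]} (hγ : γ ∈ Gamma1T Fq) (n : ℤ) :
    cocycle m ω (toInf γ • reverse (stdEdge n) : Edge Fq) =
      -act L k m (toInf γ) (stdValue (Fq := Fq) m ω n) := by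
  have h : ∃ p : Gamma1T Fq × ℤ, (toInf γ • reverse (stdEdge n) : Edge Fq) =
      toInf p.1.1 • reverse (stdEdge p.2) :=
    ⟨(⟨γ, hγ⟩, n), rfl⟩
  have h' : ¬∃ p : Gamma1T Fq × ℤ, (toInf γ • reverse (stdEdge n) : Edge Fq) =
      toInf p.1.1 • stdEdge p.2 := by
    rintro ⟨⟨⟨δ, hδ⟩, l⟩, hp⟩
    refine smul_stdEdge_ne_reverse (mul_mem (inv_mem hγ) hδ) l n ?_
    rw [map_mul, map_inv, mul_smul, ← hp, inv_smul_smul]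
  rw [cocycle, dif_neg h', dif_pos h, neg_inj]
  refine act_stdValue_eq ω h.choose.1.2 hγ ?_
  have := congrArg reverse h.choose_spec
  rw [reverse_smul, reverse_smul, reverse_reverse, reverse_reverse] at this
  exact this.symm

theorem cocycle_reverse (ω : Module.Dual L (V L k)) (e : Edge Fq) :
    cocycle m ω (reverse e) = -cocycle m ω e := by
  obtain ⟨γ, hγ, n, rfl | rfl⟩ := exists_smul_stdEdge e
  · rw [reverse_smul, cocycle_smul_reverse_stdEdge ω hγ, cocycle_smul_stdEdge ω hγ]
  · rw [reverse_smul, reverse_reverse, cocycle_smul_reverse_stdEdge ω hγ,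
      cocycle_smul_stdEdge ω hγ, neg_neg]

theorem cocycle_smul (ω : Module.Dual L (V L k)) {γ : Matrix.GeneralLinearGroup (Fin 2) Fq[X]}
    (hγ : γ ∈ Gamma1T Fq) (e : Edge Fq) :
    cocycle m ω (toInf γ • e) = act L k m (toInf γ) (cocycle m ω e) := by
  obtain ⟨δ, hδ, n, rfl | rfl⟩ := exists_smul_stdEdge e
  · rw [← mul_smul, ← map_mul, cocycle_smul_stdEdge ω (mul_mem hγ hδ), cocycle_smul_stdEdge ω hδ,
      map_mul, act_mul]
  · rw [← mul_smul, ← map_mul, cocycle_smul_reverse_stdEdge ω (mul_mem hγ hδ),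
      cocycle_smul_reverse_stdEdge ω hδ, map_mul, act_mul, map_neg]

theorem cocycle_stdEdge (ω : Module.Dual L (V L k)) (n : ℤ) :
    cocycle m ω (stdEdge n : Edge Fq) = stdValue (Fq := Fq) m ω n := by
  have := cocycle_smul_stdEdge (m := m) ω (one_mem (Gamma1T Fq)) n
  rwa [map_one, one_smul, act_one] at this

theorem cocycle_eBar (ω : Module.Dual L (V L k)) : cocycle m ω (eBar Fq) = ω := by
  rw [← stdEdge_zero, cocycle_stdEdge]; rfl

/-- Equivariance reduces to vertices of the apartment, where the vanishing is exactly the recursion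
that defines `unipotentSum`. -/
theorem cocycle_finsum_origin (ω : Module.Dual L (V L k)) (v : Vertex Fq) :
    ∑ᶠ (e : Edge Fq) (_ : origin e = v), cocycle m ω e = 0 := by
  obtain ⟨γ, hγ, n, rfl⟩ := exists_origin_eq_smul v
  rw [finsum_origin_smul]
  simp only [cocycle_smul ω hγ]
  refine (finsum_origin_map (act L k m (toInf γ)).toAddMonoidHom _ _).trans ?_
  refine (congrArg _ ?_).trans (map_zero (act L k m (toInf γ)).toAddMonoidHom)
  rcases le_or_gt 0 n with hn | hn
  · lift n to ℕ using hn
    rw [finsum_origin_of_nonneg, cocycle_reverse, cocycle_stdEdge]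
    simp only [cocycle_smul_stdEdge ω (upperPoly_mem _), stdValue_natCast]
    rw [neg_add_eq_zero]
    exact_mod_cast stdValue_natCast ω (n + 1)
  · obtain ⟨l, rfl⟩ : ∃ l : ℕ, n = -(l : ℤ) - 1 := ⟨(-n - 1).toNat, by omega⟩
    rw [finsum_origin_of_neg, cocycle_stdEdge]
    simp only [cocycle_smul_reverse_stdEdge ω (lowerPoly_mem _), stdValue_neg_natCast]
    rw [Finset.sum_neg_distrib, add_neg_eq_zero, ← neg_add']
    exact_mod_cast stdValue_neg_natCast ω (l + 1)

theorem cocycle_mem (ω : Module.Dual L (V L k)) :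
    cocycle m ω ∈ harmonicCocycles L k m (Gamma1T Fq) := by
  refine ⟨fun v => ?_, cocycle_reverse ω, fun γ hγ e => cocycle_smul ω hγ e⟩
  rw [finsum_terminus_eq_neg _ (cocycle_reverse ω), cocycle_finsum_origin, neg_zero]

/-- Harmonicity, read as a recursion outwards from `ē` in both directions, leaves no freedom once
the value at `ē` is given. -/
theorem apply_stdEdge {c : Edge Fq → Module.Dual L (V L k)}
    (hc : c ∈ harmonicCocycles L k m (Gamma1T Fq)) (n : ℤ) :
    c (stdEdge n) = stdValue (Fq := Fq) m (c (eBar Fq)) n := by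
  obtain ⟨hsum, hrev, hact⟩ := hc
  have hsum' : ∀ v, ∑ᶠ (e : Edge Fq) (_ : origin e = v), c e = 0 := fun v => by
    rw [← neg_eq_zero, ← finsum_terminus_eq_neg c hrev]; exact hsum v
  have hpos : ∀ n : ℕ, c (stdEdge n) = unipotentSum (Fq := Fq) (upperAct m) (c (eBar Fq)) n := by
    intro n
    induction n with
    | zero => exact congrArg c stdEdge_zero
    | succ n ih =>
      have h := hsum' (QuotientGroup.mk (diagT (n : ℤ)))
      rw [finsum_origin_of_nonneg, hrev, neg_add_eq_zero] at h
      simp only [hact _ (upperPoly_mem _), ih] at h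
      exact_mod_cast h
  have hneg : ∀ n : ℕ,
      c (stdEdge (-n)) = unipotentSum (Fq := Fq) (lowerAct m) (c (eBar Fq)) n := by
    intro n
    induction n with
    | zero => exact congrArg c stdEdge_zero
    | succ n ih =>
      have h := hsum' (QuotientGroup.mk (diagT (-(n : ℤ) - 1)))
      rw [finsum_origin_of_neg] at h
      simp only [hact _ (lowerPoly_mem _), hrev, ih, map_neg] at h
      rw [Finset.sum_neg_distrib, add_neg_eq_zero, ← neg_add'] at h
      exact_mod_cast h
  rcases le_total 0 n with hn | hn
  · lift n to ℕ using hn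
    rw [hpos, stdValue_natCast]
  · obtain ⟨l, rfl⟩ : ∃ l : ℕ, n = -l := ⟨(-n).toNat, by omega⟩
    rw [hneg, stdValue_neg_natCast]

/-- A harmonic cocycle for `Γ₁(t)` is determined by its value on `ē`. -/
theorem eq_cocycle {c : Edge Fq → Module.Dual L (V L k)}
    (hc : c ∈ harmonicCocycles L k m (Gamma1T Fq)) : c = cocycle m (c (eBar Fq)) := by
  funext e
  have hrev : ∀ e, c (reverse e) = -c e := hc.2.1
  have hact : ∀ γ ∈ Gamma1T Fq, ∀ e, c (toInf γ • e) = act L k m (toInf γ) (c e) := hc.2.2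
  obtain ⟨γ, hγ, n, rfl | rfl⟩ := exists_smul_stdEdge e
  · rw [hact γ hγ, apply_stdEdge hc, cocycle_smul_stdEdge _ hγ]
  · rw [hact γ hγ, hrev, apply_stdEdge hc, cocycle_smul_reverse_stdEdge _ hγ, map_neg]

/-- Evaluation at `ē` identifies the harmonic cocycles for `Γ₁(t)` with `Hom(V(k,m), L)`. -/
def evalEquiv (Fq : Type*) [Field Fq] [Fintype Fq] [DecidableEq (RatFunc Fq)] (L : Type*) [Field L]
    [Algebra (Finf Fq) L] (k : ℕ) (m : ℤ) :
    harmonicCocycles L k m (Gamma1T Fq) ≃ₗ[L] Module.Dual L (V L k) where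
  toFun c := c.1 (eBar Fq)
  map_add' _ _ := rfl
  map_smul' _ _ := rfl
  invFun ω := ⟨cocycle m ω, cocycle_mem ω⟩
  left_inv c := Subtype.ext (eq_cocycle c.2).symm
  right_inv ω := cocycle_eBar ω

end Construction

/-! ### The monomial basis of `V(k,m)`. -/

section MonomialBasis

variable (L : Type*) [Field L]

theorem mono_eq_monomial (k : ℕ) (i : Fin (k - 1)) :
    (mono L k i).1 = MvPolynomial.monomial
      (Finsupp.single 0 (i : ℕ) + Finsupp.single 1 (k - 2 - i)) 1 := by
  change MvPolynomial.X 0 ^ (i : ℕ) * MvPolynomial.X 1 ^ (k - 2 - (i : ℕ)) = _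
  rw [MvPolynomial.X_pow_eq_monomial, MvPolynomial.X_pow_eq_monomial, MvPolynomial.monomial_mul,
    one_mul]

theorem exponent_injective (k : ℕ) : Function.Injective fun i : Fin (k - 1) =>
    (Finsupp.single 0 (i : ℕ) + Finsupp.single 1 (k - 2 - i) : Fin 2 →₀ ℕ) := by
  intro i j h
  have := DFunLike.congr_fun h 0
  simpa [Fin.ext_iff] using this

/-- The basis of monomials of the homogeneous polynomials of degree `k - 2`. -/
def monoBasis (k : ℕ) (hk : 2 ≤ k) : Module.Basis (Fin (k - 1)) L (V L k) :=
  Module.Basis.mk (v := mono L k)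
    (by
      refine LinearIndependent.of_comp (V L k).subtype ?_
      have h : (V L k).subtype ∘ mono L k = MvPolynomial.basisMonomials (Fin 2) L ∘
          fun i : Fin (k - 1) =>
            (Finsupp.single 0 (i : ℕ) + Finsupp.single 1 (k - 2 - i) : Fin 2 →₀ ℕ) := by
        funext i
        simp only [Function.comp_apply, MvPolynomial.coe_basisMonomials]
        exact mono_eq_monomial L k i
      rw [h]
      exact (MvPolynomial.basisMonomials (Fin 2) L).linearIndependent.comp _ (exponent_injective k))
    (by
      rintro ⟨p, hp⟩ -
      have hmem : p ∈ (Submodule.span L (Set.range (mono L k))).map (V L k).subtype := by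
        rw [p.as_sum]
        refine Submodule.sum_mem _ fun d hd => ?_
        have hdeg : d 0 + d 1 = k - 2 := by
          have := (MvPolynomial.mem_homogeneousSubmodule _ _).mp hp
            (MvPolynomial.mem_support_iff.mp hd)
          simpa [Finsupp.weight_apply, Finsupp.sum_fintype, Fin.sum_univ_two] using this
        have hd' : d = Finsupp.single 0 (d 0) + Finsupp.single 1 (k - 2 - d 0) := by
          ext i
          fin_cases i
          · simp
          · simp; omega
        have : MvPolynomial.monomial d (p.coeff d) =
            p.coeff d • (mono L k ⟨d 0, by omega⟩).1 := by
          rw [mono_eq_monomial, MvPolynomial.smul_monomial, smul_eq_mul, mul_one, ← hd']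
        rw [this]
        exact Submodule.smul_mem _ _ ⟨_, Submodule.subset_span ⟨_, rfl⟩, rfl⟩
      obtain ⟨y, hy, hyp⟩ := hmem
      have : y = ⟨p, hp⟩ := Subtype.ext hyp
      rwa [← this])

theorem monoBasis_apply (k : ℕ) (hk : 2 ≤ k) (i : Fin (k - 1)) :
    monoBasis L k hk i = mono L k i := by
  rw [monoBasis, Module.Basis.mk_apply]

end MonomialBasis

/-! ### Power sums over `𝔽_q` and binomial coefficients. -/

section Coefficients

/-- The case `e = 0` must be set apart: with `0 ^ 0 = 1` the sum is `q`, which is 0 in `L`, whereas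
for `e > 0` only units contribute. -/
theorem sum_pow_eq {K L : Type*} [Field K] [Fintype K] [Field L] (ρ : K →+* L) (e : ℕ) :
    ∑ α : K, ρ α ^ e = if e ≠ 0 ∧ Fintype.card K - 1 ∣ e then -1 else 0 := by
  classical
  have h : ∑ α : K, ρ α ^ e = ρ (∑ α : K, α ^ e) := by simp only [map_sum, map_pow]
  rw [h]
  rcases eq_or_ne e 0 with rfl | he
  · simp
  · have h0 : ∑ α : K, α ^ e = ∑ x : Kˣ, (x : K) ^ e := by
      rw [← Finset.sum_erase_add _ _ (Finset.mem_univ (0 : K)), zero_pow he, add_zero]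
      refine (Finset.sum_bij (fun (x : Kˣ) _ => (x : K)) ?_ ?_ ?_ ?_).symm
      · intro x _; simp
      · intro x _ y _ h; exact Units.ext h
      · intro b hb; exact ⟨Units.mk0 b (Finset.ne_of_mem_erase hb), Finset.mem_univ _, rfl⟩
      · intro x _; rfl
    rw [h0, FiniteField.sum_pow_units]
    simp only [he, ne_eq, not_false_eq_true, true_and]
    split_ifs <;> simp

/-- On units the inverse is the power `q - 2`, so this is a power sum over the unit group with
exponent `≡ i - j` modulo `q - 1`. Zero is excluded, so exponent 0 gives `-1` here. -/
theorem sum_pow_mul_inv_pow_eq {K L : Type*} [Field K] [Fintype K] [DecidableEq K] [Field L]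
    (ρ : K →+* L) (i j : ℕ) :
    ∑ β ∈ Finset.univ.erase (0 : K), ρ β ^ i * ρ β⁻¹ ^ j =
      if ((Fintype.card K : ℤ) - 1) ∣ (i : ℤ) - j then -1 else 0 := by
  have hq : 2 ≤ Fintype.card K := Fintype.one_lt_card
  have h0 : ∑ β ∈ Finset.univ.erase (0 : K), ρ β ^ i * ρ β⁻¹ ^ j =
      ρ (∑ x : Kˣ, (x : K) ^ (i + (Fintype.card K - 2) * j)) := by
    rw [map_sum]
    refine (Finset.sum_bij (fun (x : Kˣ) _ => (x : K)) ?_ ?_ ?_ ?_).symm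
    · intro x _; simp
    · intro x _ y _ h; exact Units.ext h
    · intro b hb; exact ⟨Units.mk0 b (Finset.ne_of_mem_erase hb), Finset.mem_univ _, rfl⟩
    · intro x _
      have hx : (x : K)⁻¹ = (x : K) ^ (Fintype.card K - 2) := by
        refine (eq_inv_of_mul_eq_one_left ?_).symm
        rw [← pow_succ, show Fintype.card K - 2 + 1 = Fintype.card K - 1 by omega,
          FiniteField.pow_card_sub_one_eq_one _ x.ne_zero]
      rw [hx, map_pow, map_pow, ← pow_mul, pow_add]
  have hiff : Fintype.card K - 1 ∣ i + (Fintype.card K - 2) * j ↔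
      ((Fintype.card K : ℤ) - 1) ∣ (i : ℤ) - j := by
    rw [← Int.natCast_dvd_natCast]
    push_cast [show 1 ≤ Fintype.card K by omega, hq]
    rw [show (i : ℤ) + ((Fintype.card K : ℤ) - 2) * j =
      (i - j) + ((Fintype.card K : ℤ) - 1) * j by ring]
    exact dvd_add_left (dvd_mul_right _ _)
  rw [h0, FiniteField.sum_pow_units]
  simp only [hiff]
  split_ifs <;> simp

/-- In `𝔽_q` one has `(-1) ^ (q - 1) = 1`, also for even `q`, where `-1 = 1`. -/
theorem neg_one_pow_eq_of_dvd {K L : Type*} [Field K] [Fintype K] [Field L] (ρ : K →+* L)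
    {i j : ℕ} (h : ((Fintype.card K : ℤ) - 1) ∣ (i : ℤ) - j) : (-1 : L) ^ i = (-1) ^ j := by
  have hq : 2 ≤ Fintype.card K := Fintype.one_lt_card
  have h1 : (-1 : L) ^ (Fintype.card K - 1) = 1 := by
    have := congrArg ρ (FiniteField.pow_card_sub_one_eq_one (-1 : K) (by simp))
    simpa using this
  obtain ⟨a, ha⟩ := h
  have hL : (-1 : L) ≠ 0 := by simp
  rw [← zpow_natCast, ← zpow_natCast, show (i : ℤ) = ((Fintype.card K : ℤ) - 1) * a + j by omega,
    zpow_add₀ hL, zpow_mul]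
  have : ((Fintype.card K : ℤ) - 1) = ((Fintype.card K - 1 : ℕ) : ℤ) := by omega
  rw [this, zpow_natCast (-1 : L), h1, one_zpow, one_mul]

/-- A coefficient of `X ^ i * Y ^ i' * (aX + bY) ^ M`. -/
theorem coeff_mul_linear_pow {L : Type*} [Field L] (a b : L) (i i' M j j' : ℕ)
    (hj : j + j' = i + i' + M) :
    MvPolynomial.coeff (Finsupp.single 0 j + Finsupp.single 1 j' : Fin 2 →₀ ℕ)
      (MvPolynomial.X 0 ^ i * MvPolynomial.X 1 ^ i' *
        (MvPolynomial.C a * MvPolynomial.X 0 + MvPolynomial.C b * MvPolynomial.X 1) ^ M :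
          MvPolynomial (Fin 2) L) =
      if i ≤ j then (M.choose (j - i) : L) * a ^ (j - i) * b ^ (M - (j - i)) else 0 := by
  have hterm : ∀ l ∈ Finset.range (M + 1),
      (MvPolynomial.X 0 ^ i * MvPolynomial.X 1 ^ i' *
        ((MvPolynomial.C a * MvPolynomial.X 0) ^ l * (MvPolynomial.C b * MvPolynomial.X 1) ^ (M - l) *
          ((M.choose l : ℕ) : MvPolynomial (Fin 2) L))) =
      MvPolynomial.monomial (Finsupp.single 0 (i + l) + Finsupp.single 1 (i' + (M - l)))
        ((M.choose l : L) * a ^ l * b ^ (M - l)) := by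
    intro l _
    have : (MvPolynomial.monomial (Finsupp.single 0 (i + l) + Finsupp.single 1 (i' + (M - l)))
        ((M.choose l : L) * a ^ l * b ^ (M - l)) : MvPolynomial (Fin 2) L) =
        MvPolynomial.C ((M.choose l : L) * a ^ l * b ^ (M - l)) *
          (MvPolynomial.X 0 ^ (i + l) * MvPolynomial.X 1 ^ (i' + (M - l))) := by
      rw [MvPolynomial.X_pow_eq_monomial, MvPolynomial.X_pow_eq_monomial,
        MvPolynomial.monomial_mul, MvPolynomial.C_mul_monomial, one_mul, mul_one]
    rw [this]
    simp only [map_mul, map_pow, map_natCast]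
    ring
  rw [add_pow, Finset.mul_sum, Finset.sum_congr rfl hterm, MvPolynomial.coeff_sum]
  simp only [MvPolynomial.coeff_monomial]
  have hiff : ∀ l ∈ Finset.range (M + 1),
      ((Finsupp.single 0 (i + l) + Finsupp.single 1 (i' + (M - l)) : Fin 2 →₀ ℕ) =
        Finsupp.single 0 j + Finsupp.single 1 j') ↔ i + l = j := by
    intro l hl
    have hl' := Finset.mem_range.mp hl
    constructor
    · intro h
      simpa using DFunLike.congr_fun h 0
    · rintro rfl
      congr 2
      omega
  rw [Finset.sum_congr rfl fun l hl => if_congr (hiff l hl) rfl rfl]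
  split_ifs with hij
  · by_cases hM : j - i ≤ M
    · rw [Finset.sum_eq_single (j - i), if_pos (by omega)]
      · intro l _ hl
        rw [if_neg (by omega)]
      · intro h
        exact absurd (Finset.mem_range.mpr (by omega)) h
    · rw [Nat.choose_eq_zero_of_lt (by omega), Nat.cast_zero, zero_mul, zero_mul]
      refine Finset.sum_eq_zero fun l hl => ?_
      have := Finset.mem_range.mp hl
      rw [if_neg (by omega)]
  · exact Finset.sum_eq_zero fun l _ => by rw [if_neg (by omega)]

theorem monoBasis_coord {L : Type*} [Field L] (k : ℕ) (hk : 2 ≤ k) (j : Fin (k - 1)) (p : V L k) :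
    (monoBasis L k hk).coord j p =
      MvPolynomial.coeff (Finsupp.single 0 (j : ℕ) + Finsupp.single 1 (k - 2 - j)) p.1 := by
  have : (monoBasis L k hk).coord j = (MvPolynomial.lcoeff L
      (Finsupp.single 0 (j : ℕ) + Finsupp.single 1 (k - 2 - j))).comp (V L k).subtype := by
    refine (monoBasis L k hk).ext fun i => ?_
    rw [Module.Basis.coord_apply, Module.Basis.repr_self, LinearMap.comp_apply, monoBasis_apply]
    change _ = MvPolynomial.coeff _ (mono L k i).1
    rw [mono_eq_monomial, MvPolynomial.coeff_monomial, Finsupp.single_apply]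
    refine if_congr ?_ rfl rfl
    exact (exponent_injective k).eq_iff.symm
  rw [this]; rfl

end Coefficients

/-! ### The matrices `(1 β; 0 t)` and stability under `U_t`. -/

section Hecke

variable {Fq : Type*} [Field Fq] [DecidableEq (RatFunc Fq)]

theorem val_heckeMatrix (β : Fq) :
    (heckeMatrix β).val = !![1, ofPoly Fq (C β); 0, tInf Fq] := rfl

theorem val_heckeMatrix_inv (β : Fq) :
    (heckeMatrix β)⁻¹.val = !![1, -(ofPoly Fq (C β) / tInf Fq); 0, (tInf Fq)⁻¹] := rfl

theorem ofPoly_X : ofPoly Fq X = tInf Fq := rfl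

/-- The matrices `(1 β; 0 t)` are permuted, up to `Γ₁(t)`, by right multiplication by `Γ₁(t)`. -/
theorem exists_heckeMatrix_mul {γ : Matrix.GeneralLinearGroup (Fin 2) Fq[X]} (hγ : γ ∈ Gamma1T Fq)
    (β : Fq) : ∃ γ' ∈ Gamma1T Fq,
      heckeMatrix β * toInf γ = toInf γ' * heckeMatrix ((γ.val 0 1).coeff 0 + β) := by
  have hdetu : IsUnit γ.val.det := (Matrix.isUnit_iff_isUnit_det _).mp γ.isUnit
  obtain ⟨ha, hd, hc⟩ := hγ
  rw [Ideal.mem_span_singleton] at ha hd hc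
  rw [Matrix.det_fin_two] at hdetu
  have hval := val_toInf γ
  generalize γ.val 0 0 = a, γ.val 0 1 = b, γ.val 1 0 = c, γ.val 1 1 = d at *
  set β' := b.coeff 0 + β with hβ'
  -- Solving for `γ'` requires dividing its upper right entry by `t`. The constant term of the
  -- numerator is `b(0) + β - β'`, which dictates the choice of `β'`.
  obtain ⟨b', hb'⟩ : X ∣ b + C β * d - C β' * (a + C β * c) := by
    rw [X_dvd_iff] at ha hd hc ⊢
    simp only [coeff_sub, coeff_one_zero, sub_eq_zero] at ha hd
    simp [mul_coeff_zero, ha, hd, hc, hβ']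
  have hdet : IsUnit (!![a + C β * c, b'; X * c, d - C β' * c] : Matrix _ _ Fq[X]).det := by
    rw [Matrix.det_fin_two]
    convert hdetu using 1
    simp
    linear_combination c * hb'
  refine ⟨Matrix.nonsingInvUnit _ hdet, ⟨?_, ?_, ?_⟩, ?_⟩
  · change a + C β * c - 1 ∈ _
    rw [Ideal.mem_span_singleton, add_sub_right_comm]
    exact dvd_add ha (hc.mul_left _)
  · change d - C β' * c - 1 ∈ _
    rw [Ideal.mem_span_singleton, sub_right_comm]
    exact dvd_sub hd (hc.mul_left _)
  · change X * c ∈ _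
    exact Ideal.mem_span_singleton.mpr (dvd_mul_right _ _)
  · apply Units.ext
    have h' : (toInf (Matrix.nonsingInvUnit _ hdet)).val = !![ofPoly Fq (a + C β * c), ofPoly Fq b';
        ofPoly Fq (X * c), ofPoly Fq (d - C β' * c)] := val_toInf _
    have hb'' := congrArg (ofPoly Fq) hb'
    simp only [map_sub, map_add, map_mul, ofPoly_X] at hb''
    rw [Units.val_mul, Units.val_mul, h', hval, val_heckeMatrix, val_heckeMatrix,
      Matrix.mul_fin_two, Matrix.mul_fin_two]
    simp only [map_sub, map_add, map_mul, ofPoly_X]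
    ext i j
    fin_cases i <;> fin_cases j
    · simp
    · simp
      linear_combination hb''
    · simp
    · simp
      ring

/-- Up to the scalar `t`, the matrix `diag(1, t)` is `diag(t⁻¹, 1)`. -/
theorem heckeMatrix_zero_smul_eBar : heckeMatrix (0 : Fq) • eBar Fq = stdEdge (-1) := by
  refine mk_eq_mk (g := heckeMatrix (0 : Fq) * swapMatrix) (h := diagT (-1) * swapMatrix)
    (tInf Fq)⁻¹ (inv_ne_zero tInf_ne_zero) 1
    (one_mem _) ?_
  rw [Units.val_mul, Units.val_mul, val_heckeMatrix, val_swapMatrix, val_diagT, Units.val_one,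
    Matrix.mul_one, Matrix.mul_fin_two, Matrix.mul_fin_two]
  simp [tInf_ne_zero]

theorem heckeMatrix_smul_eBar {β : Fq} (hβ : β ≠ 0) :
    heckeMatrix β • eBar Fq = toInf (lowerPoly (X * C β⁻¹)) • reverse (stdEdge 0) := by
  rw [reverse_stdEdge, eq_comm]
  have hb : ofPoly Fq (C β) ≠ 0 := by
    rwa [Ne, map_eq_zero_iff _ ofPoly_injective, C_eq_zero]
  have hinv : ofPoly Fq (C β⁻¹) = (ofPoly Fq (C β))⁻¹ := by
    refine eq_inv_of_mul_eq_one_left ?_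
    rw [← map_mul, ← C_mul, inv_mul_cancel₀ hβ, C_1, map_one]
  have hv : Valued.v (ofPoly Fq (C β)) = 1 := by
    rw [v_ofPoly (C_ne_zero.mpr hβ)]; simp
  have ht := tInf_ne_zero (Fq := Fq)
  -- The Iwahori factor is found by solving `(1 β; 0 t) (0 1; 1 0) = t (1 0; tβ⁻¹ 1) diag(t⁻¹, 1)
  -- κ`.
  let κ : GLinf Fq := Matrix.nonsingInvUnit !![ofPoly Fq (C β), 1; 0, -(ofPoly Fq (C β))⁻¹] (by
    rw [Matrix.det_fin_two]; simp [hb])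
  have hκv : κ.val = !![ofPoly Fq (C β), 1; 0, -(ofPoly Fq (C β))⁻¹] := rfl
  have hκ : κ ∈ iwahori Fq := by
    apply mem_iwahori <;> simp [hκv, hv]
  refine mk_eq_mk (g := toInf (lowerPoly (X * C β⁻¹)) * diagT (0 - 1))
    (h := heckeMatrix β * swapMatrix) (tInf Fq) ht κ hκ ?_
  rw [toInf_lowerPoly, Units.val_mul, Units.val_mul, val_heckeMatrix, val_swapMatrix, val_diagT,
    val_lowerUnipotent, hκv, Matrix.mul_fin_two, Matrix.mul_fin_two, Matrix.mul_fin_two, map_mul,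
    hinv, ofPoly_X]
  ext i j
  fin_cases i <;> fin_cases j
  · simp [ht]
  · simp [ht]
  · simp [ht]
    field_simp
  · simp [ht]
    field_simp
    ring

theorem val_heckeMatrix_inv_mul_lower (β α : Fq) :
    ((heckeMatrix β)⁻¹ * toInf (lowerPoly (X * C α))).val =
      !![1 - ofPoly Fq (C β) * ofPoly Fq (C α), -(ofPoly Fq (C β) * (tInf Fq)⁻¹);
        ofPoly Fq (C α), (tInf Fq)⁻¹] := by
  rw [toInf_lowerPoly, Units.val_mul, val_heckeMatrix_inv, val_lowerUnipotent, Matrix.mul_fin_two,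
    map_mul, ofPoly_X]
  have ht := tInf_ne_zero (Fq := Fq)
  ext i j
  fin_cases i <;> fin_cases j
  · simp; field_simp; ring
  · simp; field_simp
  · simp; field_simp
  · simp

theorem algebraMap_tInf_ne_zero {L : Type*} [Field L] [Algebra (Finf Fq) L] :
    algebraMap (Finf Fq) L (tInf Fq) ≠ 0 := by
  rw [Ne, map_eq_zero]; exact tInf_ne_zero

variable {L : Type*} [Field L] [Algebra (Finf Fq) L] {k : ℕ} {m : ℤ}

theorem substV_mono (γ : GLinf Fq) {a b c d : Finf Fq} (hγ : γ.val = !![a, b; c, d])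
    (i : Fin (k - 1)) : (substV L k γ (mono L k i)).1 =
      (MvPolynomial.C (algebraMap (Finf Fq) L a) * MvPolynomial.X 0 +
        MvPolynomial.C (algebraMap (Finf Fq) L b) * MvPolynomial.X 1) ^ (i : ℕ) *
      (MvPolynomial.C (algebraMap (Finf Fq) L c) * MvPolynomial.X 0 +
        MvPolynomial.C (algebraMap (Finf Fq) L d) * MvPolynomial.X 1) ^ (k - 2 - (i : ℕ)) := by
  have h : (substV L k γ (mono L k i)).1 =
      subst L γ (MvPolynomial.X 0 ^ (i : ℕ) * MvPolynomial.X 1 ^ (k - 2 - (i : ℕ))) := rfl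
  rw [h, map_mul, map_pow, map_pow, subst, MvPolynomial.aeval_X, MvPolynomial.aeval_X, hγ]
  rfl

theorem act_apply (γ : GLinf Fq) (ω : Module.Dual L (V L k)) (p : V L k) :
    act L k m γ ω p = algebraMap (Finf Fq) L γ.val.det ^ (1 - m) * ω (substV L k γ p) := rfl

theorem act_coord_mono (hk : 2 ≤ k) (γ : GLinf Fq) {a b c d : Finf Fq} (hγ : γ.val = !![a, b; c, d])
    (i j : Fin (k - 1)) :
    act L k m γ ((monoBasis L k hk).coord j) (mono L k i) =
      algebraMap (Finf Fq) L (a * d - b * c) ^ (1 - m) *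
        MvPolynomial.coeff (Finsupp.single 0 (j : ℕ) + Finsupp.single 1 (k - 2 - j))
          ((MvPolynomial.C (algebraMap (Finf Fq) L a) * MvPolynomial.X 0 +
            MvPolynomial.C (algebraMap (Finf Fq) L b) * MvPolynomial.X 1) ^ (i : ℕ) *
          (MvPolynomial.C (algebraMap (Finf Fq) L c) * MvPolynomial.X 0 +
            MvPolynomial.C (algebraMap (Finf Fq) L d) * MvPolynomial.X 1) ^ (k - 2 - (i : ℕ)) :
              MvPolynomial (Fin 2) L) := by
  rw [act_apply, monoBasis_coord, substV_mono γ hγ, hγ, Matrix.det_fin_two_of]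

variable [Fintype Fq]

/-- The group acts by automorphisms of the tree, so harmonicity and antisymmetry survive each single
term of `U_t`. Taking the trivial group keeps just these two conditions; equivariance holds only for
the sum over `β`. -/
theorem translate_mem {c : Edge Fq → Module.Dual L (V L k)}
    {Γ : Subgroup (Matrix.GeneralLinearGroup (Fin 2) Fq[X])}
    (hc : c ∈ harmonicCocycles L k m Γ) (g : GLinf Fq) :
    (fun e => act L k m g⁻¹ (c (g • e))) ∈
      harmonicCocycles L k m (⊥ : Subgroup (Matrix.GeneralLinearGroup (Fin 2) Fq[X])) := by
  obtain ⟨hsum, hrev, -⟩ := hc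
  have hrev' : ∀ e, act L k m g⁻¹ (c (g • reverse e)) = -act L k m g⁻¹ (c (g • e)) := fun e => by
    rw [← reverse_smul, hrev, map_neg]
  refine ⟨fun v => ?_, hrev', ?_⟩
  · rw [finsum_terminus_eq_neg _ hrev', neg_eq_zero]
    refine (finsum_origin_map (act L k m g⁻¹).toAddMonoidHom _ _).trans ?_
    refine (congrArg _ ?_).trans (map_zero (act L k m g⁻¹).toAddMonoidHom)
    rw [← finsum_origin_smul, ← neg_eq_zero, ← finsum_terminus_eq_neg c hrev]
    exact hsum _
  · rintro γ hγ e
    rw [Subgroup.mem_bot.mp hγ, map_one, one_smul, act_one]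

/-- The operator `U_t` preserves the harmonic cocycles for `Γ₁(t)`. -/
theorem Ut_mem {c : Edge Fq → Module.Dual L (V L k)}
    (hc : c ∈ harmonicCocycles L k m (Gamma1T Fq)) :
    Ut L k m c ∈ harmonicCocycles L k m (Gamma1T Fq) := by
  have hbot : Ut L k m c ∈
      harmonicCocycles L k m (⊥ : Subgroup (Matrix.GeneralLinearGroup (Fin 2) Fq[X])) := by
    have h : Ut L k m c = (algebraMap (Finf Fq) L (tInf Fq)) ^ ((k : ℤ) - m) •
        ∑ β : Fq, fun e => act L k m (heckeMatrix β)⁻¹ (c (heckeMatrix β • e)) := by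
      funext e
      simp only [Ut, LinearMap.coe_mk, AddHom.coe_mk, Pi.smul_apply, Finset.sum_apply]
    rw [h]
    exact Submodule.smul_mem _ _ (Submodule.sum_mem _ fun β _ => translate_mem hc _)
  refine ⟨hbot.1, hbot.2.1, fun γ hγ e => ?_⟩
  simp only [Ut, LinearMap.coe_mk, AddHom.coe_mk, map_smul, map_sum]
  congr 1
  -- The permutation of the `β` induced by `γ` is translation by `b(0)`.
  refine Fintype.sum_equiv (Equiv.addLeft ((γ.val 0 1).coeff 0)) _ _ fun β => ?_
  obtain ⟨γ', hγ', he⟩ := exists_heckeMatrix_mul hγ β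
  rw [Equiv.coe_addLeft, ← mul_smul, he, mul_smul, hc.2.2 γ' hγ', ← act_mul, ← act_mul]
  congr 2
  rw [inv_mul_eq_iff_eq_mul, ← mul_assoc, he, mul_inv_cancel_right]

end Hecke

/-! ### The matrix of `U_t` in the dual basis. -/

section HeckeFormula

variable {Fq : Type*} [Field Fq] [DecidableEq (RatFunc Fq)]
variable {L : Type*} [Field L] [Algebra (Finf Fq) L] {k : ℕ} {m : ℤ}

variable (Fq L) in
/-- The inclusion of `𝔽_q` into `L`. -/
def constHom : Fq →+* L := (algebraMap (Finf Fq) L).comp ((ofPoly Fq).comp C)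

/-- The normalising factor `t ^ (k - m)` cancels the dependence on `m` coming from the determinant;
the coefficient of `Y ^ (k - 2 - j)` supplies the last factor. -/
theorem t_power_identity (hk : 2 ≤ k) {τ : L} (hτ : τ ≠ 0) {j : ℕ} (hj : j ≤ k - 2) :
    τ ^ ((k : ℤ) - m) * ((τ⁻¹) ^ (1 - m) * (τ⁻¹) ^ (k - 2 - j)) = τ ^ (j + 1) := by
  rw [inv_zpow', inv_pow, ← zpow_natCast τ (k - 2 - j), ← zpow_neg, ← zpow_natCast τ (j + 1),
    ← zpow_add₀ hτ, ← zpow_add₀ hτ]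
  congr 1
  omega

/-- The matrix is `(1 0; α t⁻¹)`, so `X` is fixed and only the power of `Y` gets expanded. -/
theorem act_first (hk : 2 ≤ k) (α : Fq) (i j : Fin (k - 1)) :
    (algebraMap (Finf Fq) L (tInf Fq)) ^ ((k : ℤ) - m) *
      act L k m ((heckeMatrix 0)⁻¹ * toInf (lowerPoly (X * C α))) ((monoBasis L k hk).coord j)
        (mono L k i) =
      (algebraMap (Finf Fq) L (tInf Fq)) ^ ((j : ℕ) + 1) * if i ≤ j then
        ((k - 2 - i).choose (j - i) : L) * constHom Fq L α ^ ((j : ℕ) - i) else 0 := by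
  have hi := i.isLt
  have hj := j.isLt
  rw [act_coord_mono hk _ (val_heckeMatrix_inv_mul_lower 0 α)]
  have hC := coeff_mul_linear_pow (constHom Fq L α) (algebraMap (Finf Fq) L (tInf Fq))⁻¹ i 0
    (k - 2 - i) j (k - 2 - j) (by omega)
  rw [pow_zero, mul_one] at hC
  simp only [map_zero, zero_mul, sub_zero, map_one, neg_zero, one_mul, add_zero, map_inv₀]
  rw [show algebraMap (Finf Fq) L (ofPoly Fq (C α)) = constHom Fq L α from rfl, hC]
  by_cases hij : i ≤ j
  · have hij' : (i : ℕ) ≤ j := hij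
    rw [if_pos hij, if_pos hij', ← t_power_identity (m := m) hk algebraMap_tInf_ne_zero
      (show (j : ℕ) ≤ k - 2 by omega), show k - 2 - (i : ℕ) - (j - i) = k - 2 - j by omega]
    ring
  · have hij' : ¬(i : ℕ) ≤ j := hij
    rw [if_neg hij, if_neg hij', mul_zero, mul_zero, mul_zero]

/-- The product of `β` and `β⁻¹` kills the upper left entry: `X` goes to `-βt⁻¹Y`, and again a
single binomial expansion remains. -/
theorem act_second (hk : 2 ≤ k) {β : Fq} (hβ : β ≠ 0) (i j : Fin (k - 1)) :
    (algebraMap (Finf Fq) L (tInf Fq)) ^ ((k : ℤ) - m) *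
      act L k m ((heckeMatrix β)⁻¹ * toInf (lowerPoly (X * C β⁻¹))) ((monoBasis L k hk).coord j)
        (mono L k i) =
      (algebraMap (Finf Fq) L (tInf Fq)) ^ ((j : ℕ) + 1) * (((k - 2 - i).choose j : L) *
        (-1) ^ (i : ℕ) * (constHom Fq L β ^ (i : ℕ) * constHom Fq L β⁻¹ ^ (j : ℕ))) := by
  have hi := i.isLt
  have hj := j.isLt
  have hβ' : ofPoly Fq (C β) * ofPoly Fq (C β⁻¹) = 1 := by
    rw [← map_mul, ← C_mul, mul_inv_cancel₀ hβ, C_1, map_one]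
  rw [act_coord_mono hk _ (val_heckeMatrix_inv_mul_lower β β⁻¹)]
  have hC := coeff_mul_linear_pow (constHom Fq L β⁻¹) (algebraMap (Finf Fq) L (tInf Fq))⁻¹ 0 i
    (k - 2 - i) j (k - 2 - j) (by omega)
  rw [pow_zero, one_mul, if_pos (Nat.zero_le _), Nat.sub_zero] at hC
  have hdet : (1 - ofPoly Fq (C β) * ofPoly Fq (C β⁻¹)) * (tInf Fq)⁻¹ -
      -(ofPoly Fq (C β) * (tInf Fq)⁻¹) * ofPoly Fq (C β⁻¹) = (tInf Fq)⁻¹ := by ring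
  rw [hdet, hβ', sub_self, map_zero, map_zero, zero_mul, zero_add, mul_pow, ← map_pow, mul_assoc,
    MvPolynomial.coeff_C_mul, map_neg, map_mul, map_inv₀,
    show algebraMap (Finf Fq) L (ofPoly Fq (C β)) = constHom Fq L β from rfl,
    show algebraMap (Finf Fq) L (ofPoly Fq (C β⁻¹)) = constHom Fq L β⁻¹ from rfl, hC]
  by_cases hij : (j : ℕ) ≤ k - 2 - i
  · rw [← t_power_identity (m := m) hk algebraMap_tInf_ne_zero (show (j : ℕ) ≤ k - 2 by omega),
      show k - 2 - (j : ℕ) = i + (k - 2 - i - j) by omega, pow_add, neg_pow, mul_pow]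
    ring
  · rw [Nat.choose_eq_zero_of_lt (by omega)]
    simp

variable [Fintype Fq]

open scoped Classical in
-- The first sum is the value at `stdEdge (-1)`, one step of the recursion away from `ē`. The minus
-- sign comes from the reversal of `ē` for `β ≠ 0`.
theorem Ut_apply_eBar {c : Edge Fq → Module.Dual L (V L k)}
    (hc : c ∈ harmonicCocycles L k m (Gamma1T Fq)) :
    Ut L k m c (eBar Fq) = (algebraMap (Finf Fq) L (tInf Fq)) ^ ((k : ℤ) - m) •
      ((∑ α : Fq, act L k m ((heckeMatrix 0)⁻¹ * toInf (lowerPoly (X * C α))) (c (eBar Fq))) -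
        ∑ β ∈ Finset.univ.erase (0 : Fq),
          act L k m ((heckeMatrix β)⁻¹ * toInf (lowerPoly (X * C β⁻¹))) (c (eBar Fq))) := by
  have h0 : c (stdEdge (-1)) = ∑ α : Fq, act L k m (toInf (lowerPoly (X * C α))) (c (eBar Fq)) := by
    have h1 := stdValue_neg_natCast (Fq := Fq) (m := m) (c (eBar Fq)) 1
    rw [Nat.cast_one, unipotentSum, unipotentSum] at h1
    rw [apply_stdEdge hc, h1]
    simp only [lowerAct, pow_zero, mul_one]
  have hβ : ∀ β ∈ Finset.univ.erase (0 : Fq), act L k m (heckeMatrix β)⁻¹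
      (c (heckeMatrix β • eBar Fq)) =
      -act L k m ((heckeMatrix β)⁻¹ * toInf (lowerPoly (X * C β⁻¹))) (c (eBar Fq)) := by
    intro β hβ
    have hrev : ∀ e, c (reverse e) = -c e := hc.2.1
    rw [heckeMatrix_smul_eBar (Finset.ne_of_mem_erase hβ), hc.2.2 _ (lowerPoly_mem _), hrev,
      stdEdge_zero, map_neg, map_neg, act_mul]
  simp only [Ut, LinearMap.coe_mk, AddHom.coe_mk]
  rw [← Finset.sum_erase_add _ _ (Finset.mem_univ (0 : Fq)), Finset.sum_congr rfl hβ,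
    heckeMatrix_zero_smul_eBar, h0, map_sum, Finset.sum_neg_distrib, neg_add_eq_sub]
  simp only [act_mul]

/-- The matrix of `U_t` with respect to the values on `ē`. -/
theorem Ut_apply_eBar_mono (hk : 2 ≤ k) {c : Edge Fq → Module.Dual L (V L k)}
    (hc : c ∈ harmonicCocycles L k m (Gamma1T Fq)) (i j : Fin (k - 1))
    (hcj : c (eBar Fq) = (monoBasis L k hk).coord j) :
    Ut L k m c (eBar Fq) (mono L k i) = (algebraMap (Finf Fq) L (tInf Fq)) ^ ((j : ℕ) + 1) *
      ((if i < j ∧ ((Fintype.card Fq : ℤ) - 1) ∣ (i : ℤ) - (j : ℕ) then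
          -((k - 2 - i).choose (j - i) : L) else 0) +
        if ((Fintype.card Fq : ℤ) - 1) ∣ (i : ℤ) - (j : ℕ) then
          (-1) ^ (i : ℕ) * ((k - 2 - i).choose j : L) else 0) := by
  classical
  rw [Ut_apply_eBar hc, hcj, LinearMap.smul_apply, LinearMap.sub_apply, LinearMap.sum_apply,
    LinearMap.sum_apply, smul_eq_mul, mul_sub, Finset.mul_sum, Finset.mul_sum]
  rw [Finset.sum_congr rfl fun α _ => act_first hk α i j,
    Finset.sum_congr rfl fun β hβ => act_second hk (Finset.ne_of_mem_erase hβ) i j,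
    ← Finset.mul_sum, ← Finset.mul_sum, ← mul_sub, ← Finset.mul_sum, sum_pow_mul_inv_pow_eq,
    sub_eq_add_neg]
  congr 2
  · by_cases hij : i ≤ j
    · have hij' : (i : ℕ) ≤ j := hij
      simp only [if_pos hij]
      rw [← Finset.mul_sum, sum_pow_eq]
      have hiff : ((j : ℕ) - i ≠ 0 ∧ Fintype.card Fq - 1 ∣ (j : ℕ) - i) ↔
          (i < j ∧ ((Fintype.card Fq : ℤ) - 1) ∣ (i : ℤ) - (j : ℕ)) := by
        refine and_congr ?_ ?_
        · rw [Fin.lt_def]; omega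
        · rw [← Int.natCast_dvd_natCast, dvd_sub_comm, Nat.cast_sub hij',
            Nat.cast_sub Fintype.card_pos]
          simp
      simp only [hiff]
      split_ifs <;> simp
    · rw [if_neg fun h => hij h.1.le]
      simp only [if_neg hij, Finset.sum_const_zero]
  · split_ifs
    · ring
    · simp

theorem extendByZero_of_nonneg {M : Type*} [Zero M] (c : Fin (k - 1) → M) (i : Fin (k - 1)) {x : ℤ}
    (hx : x = (i : ℕ)) : extendByZero c x = c i := by
  subst hx
  rw [extendByZero, dif_pos ⟨by omega, by simp⟩]
  congr 1

theorem extendByZero_eq_zero_or {M : Type*} [Zero M] (c : Fin (k - 1) → M) (x : ℤ) :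
    extendByZero c x = 0 ∨ ∃ i : Fin (k - 1), x = (i : ℕ) ∧ extendByZero c x = c i := by
  by_cases h : 0 ≤ x ∧ x.toNat < k - 1
  · exact Or.inr ⟨⟨x.toNat, h.2⟩, by simp [h.1], by rw [extendByZero, dif_pos h]⟩
  · exact Or.inl (by rw [extendByZero, dif_neg h])

/-- Finiteness is what allows a linear functional to pass through the `finsum`. -/
theorem finite_support_extendByZero {M : Type*} [AddCommGroup M] [Module L M]
    (c : Fin (k - 1) → M) (a : ℤ → L) (j : ℕ) {d : ℤ} (hd : 1 ≤ d) :
    (Function.support fun h : ℤ => a h • extendByZero c (j + h * d)).Finite := by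
  refine (Set.finite_Icc (-(j : ℤ)) k).subset fun h hh => ?_
  rcases extendByZero_eq_zero_or c (j + h * d) with h0 | ⟨i, hi, -⟩
  · exact absurd (by simp only [h0, smul_zero]) hh
  · have := i.isLt
    refine ⟨?_, ?_⟩
    · by_contra hc
      have := le_mul_of_one_le_right (show 0 ≤ -h by omega) hd
      rw [neg_mul] at this
      omega
    · by_contra hc
      have := le_mul_of_one_le_right (show 0 ≤ h by omega) hd
      omega

/-- The evaluation at `ē` of the sum in the formula for `U_t`. -/
theorem finsum_extendByZero_apply {M : Type*} [AddCommGroup M] [Module L M]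
    (c : Fin (k - 1) → M) (a : ℤ → L) (j i : Fin (k - 1)) {d : ℤ} (hd : 1 ≤ d) (φ : M →ₗ[L] L)
    (hφ : ∀ l, φ (c l) = if i = l then 1 else 0) :
    φ (∑ᶠ (h : ℤ) (_ : h ≠ 0), a h • extendByZero c ((j : ℕ) + h * d)) =
      if i ≠ j ∧ d ∣ (i : ℤ) - (j : ℕ) then a (((i : ℤ) - (j : ℕ)) / d) else 0 := by
  have hmap := φ.toAddMonoidHom.map_finsum_mem' (s := {h : ℤ | h ≠ 0})
    (f := fun h : ℤ => a h • extendByZero c ((j : ℕ) + h * d))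
    ((finite_support_extendByZero c a j hd).inter_of_right _)
  refine hmap.trans ?_
  have hval : ∀ x : ℤ, φ (extendByZero c x) = if x = (i : ℕ) then 1 else 0 := by
    intro x
    rcases extendByZero_eq_zero_or c x with h0 | ⟨l, rfl, h⟩
    · rw [h0, map_zero, if_neg]
      intro hx
      have h1 := hφ i
      rw [← extendByZero_of_nonneg c i hx, h0, map_zero, if_pos rfl] at h1
      exact zero_ne_one h1
    · rw [h, hφ]
      refine if_congr ?_ rfl rfl
      rw [Fin.ext_iff]; omega
  have hd0 : d ≠ 0 := by omega
  have hterm : ∀ h : ℤ, φ.toAddMonoidHom (a h • extendByZero c ((j : ℕ) + h * d)) =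
      if h * d = (i : ℤ) - (j : ℕ) then a h else 0 := by
    intro h
    change φ (a h • extendByZero c ((j : ℕ) + h * d)) = _
    rw [map_smul, hval, smul_eq_mul, mul_ite, mul_one, mul_zero]
    exact if_congr (by omega) rfl rfl
  simp only [hterm, Set.mem_ofPred_eq]
  -- Only `h = (i - j) / d` can contribute, and it is excluded by `h ≠ 0` exactly when `i = j`.
  rw [finsum_eq_single _ (((i : ℤ) - (j : ℕ)) / d)]
  · by_cases hdvd : d ∣ (i : ℤ) - (j : ℕ)
    · have hdiv := Int.ediv_mul_cancel hdvd
      by_cases hij : i = j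
      · subst hij
        simp
      · have h0 : ((i : ℤ) - (j : ℕ)) / d ≠ 0 := by
          intro h0
          rw [h0, zero_mul] at hdiv
          exact hij (Fin.ext (by omega))
        rw [finsum_eq_if, if_pos h0, if_pos hdiv, if_pos ⟨hij, hdvd⟩]
    · have : ¬((i : ℤ) - (j : ℕ)) / d * d = (i : ℤ) - (j : ℕ) := fun h =>
        hdvd ⟨_, by rw [mul_comm]; exact h.symm⟩
      rw [finsum_eq_if, if_neg this, ite_self, if_neg fun h => hdvd h.2]
  · intro h hh
    have : ¬h * d = (i : ℤ) - (j : ℕ) := fun he => hh (by rw [← he, Int.mul_ediv_cancel _ hd0])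
    rw [finsum_eq_if, if_neg this, ite_self]

variable (Fq L) in
/-- The harmonic cocycles dual to the monomials. -/
def cocycleBasis (k : ℕ) (hk : 2 ≤ k) (m : ℤ) :
    Module.Basis (Fin (k - 1)) L (harmonicCocycles L k m (Gamma1T Fq)) :=
  (monoBasis L k hk).dualBasis.map (evalEquiv Fq L k m).symm

theorem cocycleBasis_eBar (hk : 2 ≤ k) (j : Fin (k - 1)) :
    (cocycleBasis Fq L k hk m j).1 (eBar Fq) = (monoBasis L k hk).coord j := by
  have : evalEquiv Fq L k m (cocycleBasis Fq L k hk m j) = (monoBasis L k hk).coord j := by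
    rw [cocycleBasis, Module.Basis.map_apply, LinearEquiv.apply_symm_apply,
      Module.Basis.coe_dualBasis]
  exact this

theorem cocycleBasis_eBar_mono (hk : 2 ≤ k) (j i : Fin (k - 1)) :
    (cocycleBasis Fq L k hk m j).1 (eBar Fq) (mono L k i) = if i = j then 1 else 0 := by
  rw [cocycleBasis_eBar, ← monoBasis_apply L k hk, Module.Basis.coord_apply,
    Module.Basis.repr_self, Finsupp.single_apply]

theorem harmonic_ext (hk : 2 ≤ k) {c c' : Edge Fq → Module.Dual L (V L k)}
    (hc : c ∈ harmonicCocycles L k m (Gamma1T Fq)) (hc' : c' ∈ harmonicCocycles L k m (Gamma1T Fq))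
    (h : ∀ i, c (eBar Fq) (mono L k i) = c' (eBar Fq) (mono L k i)) : c = c' := by
  rw [eq_cocycle hc, eq_cocycle hc']
  congr 1
  exact (monoBasis L k hk).ext fun i => by rw [monoBasis_apply]; exact h i

theorem extendByZero_mem (hk : 2 ≤ k) (x : ℤ) :
    extendByZero (fun i : Fin (k - 1) => (cocycleBasis Fq L k hk m i).1) x ∈
      harmonicCocycles L k m (Gamma1T Fq) := by
  rcases extendByZero_eq_zero_or (fun i : Fin (k - 1) => (cocycleBasis Fq L k hk m i).1) x with
    h | ⟨i, -, h⟩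
  · rw [h]; exact zero_mem _
  · rw [h]; exact (cocycleBasis Fq L k hk m i).2

theorem submodule_finsum_mem {M : Type*} [AddCommGroup M] [Module L M] (S : Submodule L M)
    {P : ℤ → Prop} {f : ℤ → M} (hf : ∀ h, f h ∈ S) : ∑ᶠ (h : ℤ) (_ : P h), f h ∈ S :=
  finsum_mem_induction (· ∈ S) (zero_mem S) (fun _ _ => add_mem) fun h _ => hf h

/-- The formula for `U_t` on the basis of harmonic cocycles dual to the monomials. -/
theorem Ut_cocycleBasis (hk : 2 ≤ k) (j : Fin (k - 1)) :
    Ut L k m (cocycleBasis Fq L k hk m j).1 =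
      (-(-algebraMap (Finf Fq) L (tInf Fq)) ^ ((j : ℕ) + 1) *
        (intChoose ((k : ℤ) - 2 - (j : ℕ)) (j : ℕ) : L)) • (cocycleBasis Fq L k hk m j).1 -
      (algebraMap (Finf Fq) L (tInf Fq)) ^ ((j : ℕ) + 1) •
        ∑ᶠ (h : ℤ) (_ : h ≠ 0),
          ((intChoose ((k : ℤ) - 2 - (j : ℕ) - h * ((Fintype.card Fq : ℤ) - 1))
              (-h * ((Fintype.card Fq : ℤ) - 1)) : L) +
            (-1) ^ ((j : ℕ) + 1) *
              (intChoose ((k : ℤ) - 2 - (j : ℕ) - h * ((Fintype.card Fq : ℤ) - 1)) (j : ℕ) : L)) •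
            extendByZero (fun i : Fin (k - 1) => (cocycleBasis Fq L k hk m i).1)
              ((j : ℕ) + h * ((Fintype.card Fq : ℤ) - 1)) := by
  have hq : (1 : ℤ) ≤ (Fintype.card Fq : ℤ) - 1 := by
    have : 1 < Fintype.card Fq := Fintype.one_lt_card
    omega
  -- Both sides are harmonic cocycles, so it suffices to compare their values at `ē` on monomials.
  refine harmonic_ext (m := m) hk (Ut_mem (cocycleBasis Fq L k hk m j).2) ?_ fun i => ?_
  · refine sub_mem (Submodule.smul_mem _ _ (cocycleBasis Fq L k hk m j).2)
      (Submodule.smul_mem _ _ (submodule_finsum_mem _ fun h => Submodule.smul_mem _ _ ?_))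
    exact extendByZero_mem hk _
  rw [Ut_apply_eBar_mono hk (cocycleBasis Fq L k hk m j).2 i j (cocycleBasis_eBar hk j)]
  let φ : (Edge Fq → Module.Dual L (V L k)) →ₗ[L] L :=
    (Module.Dual.eval L (V L k) (mono L k i)).comp (LinearMap.proj (eBar Fq))
  have hφ : ∀ l, φ (cocycleBasis Fq L k hk m l).1 = if i = l then 1 else 0 := fun l =>
    cocycleBasis_eBar_mono hk l i
  refine Eq.trans ?_ (map_sub φ _ _).symm
  rw [map_smul, map_smul, hφ, finsum_extendByZero_apply _ _ j i hq φ hφ, smul_eq_mul, smul_eq_mul]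
  have hi := i.isLt
  have hj := j.isLt
  by_cases hdvd : ((Fintype.card Fq : ℤ) - 1) ∣ (i : ℤ) - (j : ℕ)
  · have hsign : (-1 : L) ^ (i : ℕ) = (-1) ^ (j : ℕ) := neg_one_pow_eq_of_dvd (constHom Fq L) hdvd
    have hchoose : ∀ a b : ℕ, intChoose (a : ℤ) (b : ℤ) = a.choose b := by
      intro a b
      simp [intChoose]
    by_cases hij : i = j
    · subst hij
      have hNi : (k : ℤ) - 2 - (i : ℕ) = ((k - 2 - i : ℕ) : ℤ) := by omega
      rw [hNi, hchoose]
      simp [neg_pow (algebraMap (Finf Fq) L (tInf Fq)), pow_succ]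
      ring
    · have hdiv := Int.ediv_mul_cancel hdvd
      rw [if_pos (show i ≠ j ∧ _ from ⟨hij, hdvd⟩), if_neg hij, if_pos hdvd, hsign,
        neg_mul (((i : ℤ) - (j : ℕ)) / _), hdiv,
        show (k : ℤ) - 2 - (j : ℕ) - (i - (j : ℕ)) = ((k - 2 - i : ℕ) : ℤ) by omega, hchoose]
      rcases lt_or_gt_of_ne hij with hlt | hlt
      · have hlt' : (i : ℕ) < j := hlt
        rw [if_pos ⟨hlt, hdvd⟩, show -((i : ℤ) - (j : ℕ)) = ((j - i : ℕ) : ℤ) by omega, hchoose]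
        ring
      · have hlt' : (j : ℕ) < i := hlt
        -- For `i > j` the first binomial has a negative lower argument; this matches the absence of
        -- that term from the matrix entry.
        have h0 : intChoose ((k - 2 - i : ℕ) : ℤ) (-((i : ℤ) - (j : ℕ))) = 0 := by
          rw [intChoose, if_neg]
          omega
        rw [if_neg fun h => hlt.not_gt h.1, h0]
        push_cast
        ring
  · have hij : i ≠ j := by
      rintro rfl
      exact hdvd (by simp)
    rw [if_neg fun h => hdvd h.2, if_neg hdvd, if_neg hij, if_neg fun h => hdvd h.2]
    ring

/-- All indices `j + h(q - 1)` occurring in the formula lie in the residue class of `j`. -/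
theorem Ut_mem_span (hk : 2 ≤ k) (r : ℕ) (f : Edge Fq → Module.Dual L (V L k))
    (hf : f ∈ Submodule.span L {f | ∃ i : Fin (k - 1), (i : ℕ) ≡ r [MOD Fintype.card Fq - 1] ∧
      f = (cocycleBasis Fq L k hk m i).1}) :
    Ut L k m f ∈ Submodule.span L {f | ∃ i : Fin (k - 1),
      (i : ℕ) ≡ r [MOD Fintype.card Fq - 1] ∧ f = (cocycleBasis Fq L k hk m i).1} := by
  have hq : 1 < Fintype.card Fq := Fintype.one_lt_card
  refine (Submodule.span_le (p := (Submodule.span L {f | ∃ i : Fin (k - 1),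
    (i : ℕ) ≡ r [MOD Fintype.card Fq - 1] ∧
      f = (cocycleBasis Fq L k hk m i).1}).comap (Ut L k m))).mpr ?_ hf
  rintro _ ⟨j, hj, rfl⟩
  rw [SetLike.mem_coe, Submodule.mem_comap, Ut_cocycleBasis]
  refine sub_mem (Submodule.smul_mem _ _ (Submodule.subset_span ⟨j, hj, rfl⟩))
    (Submodule.smul_mem _ _ (submodule_finsum_mem _ fun h => Submodule.smul_mem _ _ ?_))
  rcases extendByZero_eq_zero_or (fun i : Fin (k - 1) => (cocycleBasis Fq L k hk m i).1)
    ((j : ℕ) + h * ((Fintype.card Fq : ℤ) - 1)) with h0 | ⟨i, hi, h0⟩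
  · rw [h0]; exact zero_mem _
  · rw [h0]
    refine Submodule.subset_span ⟨i, Nat.ModEq.trans ?_ hj, rfl⟩
    rw [← Int.natCast_modEq_iff, Nat.cast_sub hq.le, Nat.cast_one, ← hi]
    exact Int.modEq_iff_dvd.mpr ⟨-h, by ring⟩

end HeckeFormula

end

end DrinfeldCocycle

theorem mainTheorem5 (Fq : Type*) [Field Fq] [Fintype Fq] [DecidableEq (RatFunc Fq)]
    (k : ℕ) (hk : 2 ≤ k) (m : ℤ) :
    (∀ c ∈ harmonicCocycles (Cinf Fq) k m
        (Gamma1 (Ideal.span {(Polynomial.X : Polynomial Fq)})),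
      Ut (Cinf Fq) k m c ∈
        harmonicCocycles (Cinf Fq) k m
          (Gamma1 (Ideal.span {(Polynomial.X : Polynomial Fq)}))) ∧
    ∃ c : Module.Basis (Fin (k - 1)) (Cinf Fq)
        (harmonicCocycles (Cinf Fq) k m
          (Gamma1 (Ideal.span {(Polynomial.X : Polynomial Fq)}))),
      (∀ j i : Fin (k - 1),
        (c j).val (eBar Fq) (mono (Cinf Fq) k i) =
          if i = j then 1 else 0) ∧
      (∀ j : Fin (k - 1),
        Ut (Cinf Fq) k m (c j).val =
          (-(-algebraMap (Finf Fq) (Cinf Fq)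
              (tInf Fq)) ^ ((j : ℕ) + 1) *
            (intChoose ((k : ℤ) - 2 - (j : ℕ)) (j : ℕ) :
              Cinf Fq)) • (c j).val -
          (algebraMap (Finf Fq) (Cinf Fq)
              (tInf Fq)) ^ ((j : ℕ) + 1) •
            ∑ᶠ (h : ℤ) (_ : h ≠ 0),
              ((intChoose
                  ((k : ℤ) - 2 - (j : ℕ) - h * ((Fintype.card Fq : ℤ) - 1))
                  (-h * ((Fintype.card Fq : ℤ) - 1)) : Cinf Fq) +
                (-1) ^ ((j : ℕ) + 1) *
                  (intChoose
                    ((k : ℤ) - 2 - (j : ℕ) - h * ((Fintype.card Fq : ℤ) - 1)) (j : ℕ) :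
                      Cinf Fq)) •
                extendByZero (fun i : Fin (k - 1) => (c i).val)
                  ((j : ℕ) + h * ((Fintype.card Fq : ℤ) - 1))) ∧
      (∀ r : ℕ,
        ∀ f ∈ Submodule.span (Cinf Fq)
            {f | ∃ i : Fin (k - 1), (i : ℕ) ≡ r [MOD Fintype.card Fq - 1] ∧ f = (c i).val},
          Ut (Cinf Fq) k m f ∈
            Submodule.span (Cinf Fq)
              {f | ∃ i : Fin (k - 1),
                (i : ℕ) ≡ r [MOD Fintype.card Fq - 1] ∧ f = (c i).val}) := by

  -- The preceding lemmas hold over any field extension `L` of `F_∞`; here `L = ℂ_∞`.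
  exact ⟨fun c hc => Ut_mem hc, cocycleBasis Fq (Cinf Fq) k hk m, cocycleBasis_eBar_mono hk,
    Ut_cocycleBasis hk, Ut_mem_span hk⟩
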